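/- Notation. Let $p\in\mathbb{N}$. $\mathcal K$ is the set of compact convex $K\subseteq\mathbb{R}^p$ with $0\in\mathrm{int}(K)$; $\|x\|_K:=\inf\{t\ge 0: x\in tK\}$ is the Minkowski functional, $\|\cdot\|$ the Euclidean norm, and $B_p(0,1)$ the Euclidean unit ball. $\mathcal F_p^K$ is the set of probability densities on $\mathbb{R}^p$ of the form $f(x)=e^{\phi(\|x\|_K)}$, where $\phi:[0,\infty)\to[-\infty,\infty)$ is upper semi-continuous, concave and decreasing (in the weak sense). For $K_1,K_2\subseteq\mathbb{R}^p$, $$d_{\mathrm{scale}}(K_1,K_2):=\inf\Bigl\{\epsilon>0:\tfrac1{1+\epsilon}K_1\subseteq K_2\subseteq(1+\epsilon)K_1\Bigr\}\qquad(\inf\emptyset:=\infty).$$ Algorithm. Given $M\in\mathbb{N}$ and $X_1,\dots,X_{n+M}\in\mathbb{R}^p$, set $k:=\lfloor\log n\rfloor$ and $\theta_m:=X_{n+m}/\|X_{n+m}\|$ for $m=1,\dots,M$. For each $m$ let $\mathcal I_m$ be the set of $i\in\{1,\dots,n\}$ such that $X_i^\top\theta_m$ is at least the $k$-th largest of the numbers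 $X_i^\top\theta_1,\dots,X_i^\top\theta_M$, and let $t_m:=|\mathcal I_m|^{-1}\sum_{i\in\mathcal I_m}\|X_i\|$ (with $t_m:=0$ if $\mathcal I_m=\emptyset$). Output $\hat K:=\mathrm{conv}\{t_1\theta_1,\dots,t_M\theta_M\}$. Proposition. There is a universal constant $C>0$, and for all $p\ge2$ and $r_0\geq 1$ there is a constant $C_{p,r_0}>0$ depending only on $p$ and $r_0$, such that the following holds. Let $n\ge1$, let $K\in\mathcal K$ and $r_2\ge r_1>0$ with $r_2/r_1=r_0$ satisfy $r_1B_p(0,1)\subseteq K\subseteq r_2B_p(0,1)$, and suppose that $r_0^2n^{-1/(p+1)}\log^3(en)\le1/64$. Let $M:=\lceil n^{(p-1)/(p+1)}\rceil$, let $X_1,\dots,X_{n+M}$ be independent and identically distributed with density $f_0\in\mathcal F_p^K$, and let $\hat K$ be the output of the algorithm above. Then with probability at least $1-C_{p,r_0}n^{-p/(p+1)}$, $$\inf_{\alpha>0}d_{\mathrm{scale}}(\alpha\hat K,K)\le C\,r_0^2\,n^{-1/(p+1)}\log^3(en).$$ -/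

import Mathlib

open MeasureTheory ProbabilityTheory
open scoped NNReal ENNReal Pointwise

noncomputable section

/-- Compact convex subsets of `ℝᵖ` that contain `0` as an interior point. -/
structure IsBodyAroundZero {p : ℕ} (K : Set (EuclideanSpace ℝ (Fin p))) : Prop where
  convex : Convex ℝ K
  isCompact : IsCompact K
  zero_mem_interior : (0 : EuclideanSpace ℝ (Fin p)) ∈ interior K

/-- Generators: upper semi-continuous, concave, decreasing functions `[0, ∞) → [-∞, ∞)`.
Concavity is only tested with strictly positive weights, so no product `0 * (-∞)` occurs. -/
structure IsGenerator (φ : ℝ≥0 → EReal) : Prop where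
  ne_top : ∀ r, φ r ≠ ⊤
  upperSemicontinuous : UpperSemicontinuous φ
  antitone : Antitone φ
  concave : ∀ (r s a b : ℝ≥0), 0 < a → 0 < b → a + b = 1 →
    ((a : ℝ) : EReal) * φ r + ((b : ℝ) : EReal) * φ s ≤ φ (a * r + b * s)

/-- `f` is a `K`-homothetic log-concave probability density centred at `0`, that is,
`f x = exp (φ ‖x‖_K)` for a generator `φ`, where `‖x‖_K = gauge K x` is the Minkowski
functional and `exp (-∞) = 0`. -/
def IsHomotheticLogConcaveDensity {p : ℕ} (K : Set (EuclideanSpace ℝ (Fin p)))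
    (f : EuclideanSpace ℝ (Fin p) → ℝ≥0∞) : Prop :=
  (∃ φ : ℝ≥0 → EReal, IsGenerator φ ∧ ∀ x, f x = EReal.exp (φ ⟨gauge K x, gauge_nonneg x⟩)) ∧
    ∫⁻ x, f x = 1

/-- `d_scale (K₁, K₂)`, the infimum of all `ε > 0` such that
`(1 + ε)⁻¹ K₁ ⊆ K₂ ⊆ (1 + ε) K₁`; it is `∞` if there is no such `ε`. -/
def dScale {p : ℕ} (K₁ K₂ : Set (EuclideanSpace ℝ (Fin p))) : ℝ≥0∞ :=
  ⨅ (ε : ℝ) (_ : 0 < ε ∧ (1 / (1 + ε)) • K₁ ⊆ K₂ ∧ K₂ ⊆ (1 + ε) • K₁), ENNReal.ofReal ε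

/-- The `k`-th largest entry (counted with multiplicity) of a finite family, for
`1 ≤ k ≤ M`: the largest `t` such that at least `k` of the entries are `≥ t`. -/
def kthMax {M : ℕ} (k : ℕ) (v : Fin M → ℝ) : ℝ :=
  sSup {t : ℝ | k ≤ (Finset.univ.filter fun m => t ≤ v m).card}

section Algorithm

variable {p n M : ℕ} (X : Fin (n + M) → EuclideanSpace ℝ (Fin p))

/-- The random directions `θ_m = X_{n+m} / ‖X_{n+m}‖`. -/
def direction (m : Fin M) : EuclideanSpace ℝ (Fin p) :=
  ‖X (Fin.natAdd n m)‖⁻¹ • X (Fin.natAdd n m)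

/-- The indices `i ∈ [n]` such that `X_iᵀ θ_m` is at least the `k`-th largest of the
numbers `X_iᵀ θ_{m'}`, with `k = ⌊log n⌋`. -/
def coneIndices (m : Fin M) : Finset (Fin n) :=
  Finset.univ.filter fun i =>
    kthMax ⌊Real.log n⌋₊ (fun m' => inner ℝ (X (Fin.castAdd M i)) (direction X m')) ≤
      inner ℝ (X (Fin.castAdd M i)) (direction X m)

/-- The average `t_m` of the Euclidean norms of the observations indexed by
`coneIndices X m` (it is `0` if there are none). -/
def radius (m : Fin M) : ℝ :=
  ((coneIndices X m).card : ℝ)⁻¹ * ∑ i ∈ coneIndices X m, ‖X (Fin.castAdd M i)‖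

/-- The output `conv {t_1 θ_1, …, t_M θ_M}` of the algorithm. -/
def estimateK : Set (EuclideanSpace ℝ (Fin p)) :=
  convexHull ℝ (Set.range fun m : Fin M => radius X m • direction X m)

end Algorithm

/-- The number `M = ⌈n^((p-1)/(p+1))⌉` of directions. -/
def numDirections (p n : ℕ) : ℕ :=
  ⌈(n : ℝ) ^ (((p : ℝ) - 1) / ((p : ℝ) + 1))⌉₊

/-- The rate `r₀² n^(-1/(p+1)) log³(e n)`. -/
def scaleRate (p n : ℕ) (r₀ : ℝ) : ℝ :=
  r₀ ^ 2 * (n : ℝ) ^ (-(1 / ((p : ℝ) + 1))) * Real.log (Real.exp 1 * n) ^ 3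

end

/-!
Write `R = gauge K X` and `U = X / ‖X‖` for an observation `X`. Its density is a function of `R`
alone and volume is homogeneous of degree `p` on every cone, so `R` and `U` are independent
(`indepFun_gauge_unitDir`), and a cap of radius `r` has `U`-probability of exact order `r ^ (p - 1)`
(`le_prob_capCone`, `prob_capCone_le`). Concavity of the generator gives a scale `t` such
that `R ≥ t / 4` with probability at least `1 / 2` and the tail of `R / t` is exponential
(`exists_scale_radial_bounds`). All constants depend only on `p` and `r₀`.

Let `η = n ^ (-1 / (p + 1))`, which is the resolution of the `M` random directions `θ_m`, and let
`δ = η log² n`. Chernoff bounds over a net of the sphere show that, except with probability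
`O (1 / n)`, every cap of radius `δ` contains at least `k = ⌊log n⌋` directions, every cap of radius
`2 η` at most `k` directions, and every cap of radius `η` at least `N` observations, with `N` of
order `η ^ (-2)`. By the first property an observation is selected only by directions within `δ` of
it; by the other two every direction selects at least `N` observations.

The selected index sets depend on the directions `U` only, so they are independent of the gauges,
and Hoeffding's inequality applies to the gauges truncated at a level `L` of order `t log n`
(`prob_selected_average_le`): the averages agree with the truncated mean `c` up to a relative error
`δ`. As the gauge is Lipschitz, `radius X m` is then `c / gauge K (θ_m)` up to a relative error of
order `r₀ δ`. Finally, a separation argument shows that points close to the boundary of `c • K` in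
`δ`-dense directions have a convex hull close to `c • K` (`smul_subset_convexHull`). The powers of
`log n` to spare in the rate absorb all constants once `n` exceeds a threshold depending on `p` and
`r₀`; below the threshold the claimed probability is nonpositive.
-/

/-! ### The Minkowski functional of a body -/

namespace IsBodyAroundZero

variable {p : ℕ} {K : Set (EuclideanSpace ℝ (Fin p))}

lemma mem_nhds (hK : IsBodyAroundZero K) : K ∈ nhds (0 : EuclideanSpace ℝ (Fin p)) :=
  mem_interior_iff_mem_nhds.1 hK.zero_mem_interior

lemma zero_mem (hK : IsBodyAroundZero K) : (0 : EuclideanSpace ℝ (Fin p)) ∈ K :=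
  interior_subset hK.zero_mem_interior

lemma absorbent (hK : IsBodyAroundZero K) : Absorbent ℝ K :=
  absorbent_nhds_zero hK.mem_nhds

lemma continuous_gauge (hK : IsBodyAroundZero K) : Continuous (gauge K) :=
  _root_.continuous_gauge hK.convex hK.mem_nhds

lemma gauge_le_one_iff (hK : IsBodyAroundZero K) (x : EuclideanSpace ℝ (Fin p)) :
    gauge K x ≤ 1 ↔ x ∈ K := by
  rw [gauge_le_one_iff_mem_closure hK.convex hK.mem_nhds, hK.isCompact.isClosed.closure_eq]

lemma gauge_pos (hK : IsBodyAroundZero K) {x : EuclideanSpace ℝ (Fin p)} (hx : x ≠ 0) :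
    0 < gauge K x :=
  (_root_.gauge_pos hK.absorbent
    (NormedSpace.isVonNBounded_of_isBounded ℝ hK.isCompact.isBounded)).2 hx

lemma gauge_smul {a : ℝ} (ha : 0 ≤ a) (x : EuclideanSpace ℝ (Fin p)) :
    gauge K (a • x) = a * gauge K x := by
  rw [gauge_smul_of_nonneg ha, smul_eq_mul]

lemma mem_smul_of_gauge_le (hK : IsBodyAroundZero K) {a : ℝ} (ha : 0 < a)
    {x : EuclideanSpace ℝ (Fin p)} (hx : gauge K x ≤ a) : x ∈ a • K := by
  rw [Set.mem_smul_set_iff_inv_smul_mem₀ ha.ne', ← hK.gauge_le_one_iff, gauge_smul (by positivity)]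
  rw [inv_mul_le_iff₀ ha]; simpa using hx

variable {r₁ r₂ : ℝ}

lemma gauge_le_add (hK : IsBodyAroundZero K) (h₁ : 0 < r₁) (hb : Metric.closedBall 0 r₁ ⊆ K)
    (x y : EuclideanSpace ℝ (Fin p)) : gauge K x ≤ gauge K y + ‖x - y‖ / r₁ := by
  have h := (hK.convex.lipschitzWith_gauge (r := ⟨r₁, h₁.le⟩) h₁
    (Metric.ball_subset_closedBall.trans hb)).dist_le_mul x y
  rw [Real.dist_eq, dist_eq_norm] at h
  have h2 := (abs_le.1 h).2
  change gauge K x - gauge K y ≤ r₁⁻¹ * ‖x - y‖ at h2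
  rw [div_eq_inv_mul]; linarith

lemma gauge_le_norm_div (h₁ : 0 < r₁) (hb : Metric.closedBall 0 r₁ ⊆ K)
    (x : EuclideanSpace ℝ (Fin p)) : gauge K x ≤ ‖x‖ / r₁ := by
  rw [le_div_iff₀ h₁, mul_comm]
  exact mul_gauge_le_norm (Metric.ball_subset_closedBall.trans hb)

lemma norm_div_le_gauge (hK : IsBodyAroundZero K) (h₂ : 0 < r₂)
    (hb : K ⊆ Metric.closedBall 0 r₂) (x : EuclideanSpace ℝ (Fin p)) :
    ‖x‖ / r₂ ≤ gauge K x :=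
  le_gauge_of_subset_closedBall hK.absorbent h₂.le hb

/-- On unit vectors the Minkowski functional varies slowly in ratio: its Lipschitz constant is
`1 / r₁` and its minimum on the sphere is at least `1 / r₂`. -/
lemma gauge_le_mul_of_unit (hK : IsBodyAroundZero K) (h₁ : 0 < r₁) (h₂ : 0 < r₂)
    (hb₁ : Metric.closedBall 0 r₁ ⊆ K) (hb₂ : K ⊆ Metric.closedBall 0 r₂)
    {x y : EuclideanSpace ℝ (Fin p)} {δ : ℝ} (hxy : ‖x - y‖ ≤ δ) (hy : ‖y‖ = 1) :
    gauge K x ≤ (1 + r₂ / r₁ * δ) * gauge K y := by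
  have h := hK.gauge_le_add h₁ hb₁ x y
  have h' := hK.norm_div_le_gauge h₂ hb₂ y
  have hδ : 0 ≤ δ := (norm_nonneg _).trans hxy
  rw [hy] at h'
  have : ‖x - y‖ / r₁ ≤ r₂ / r₁ * δ * gauge K y := by
    calc ‖x - y‖ / r₁ ≤ δ / r₁ := by gcongr
      _ = r₂ / r₁ * δ * (1 / r₂) := by field_simp
      _ ≤ _ := by gcongr
  linarith

end IsBodyAroundZero

/-! ### Selection of the nearest directions -/

/-- Membership above the `k`-th largest entry, freed of the supremum in `kthMax`: fewer than `k`
entries are strictly larger. -/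
lemma kthMax_le_iff {M k : ℕ} (hk : 1 ≤ k) (hkM : k ≤ M) (v : Fin M → ℝ) (m : Fin M) :
    kthMax k v ≤ v m ↔ (Finset.univ.filter fun m' => v m < v m').card < k := by
  classical
  have hM : (Finset.univ : Finset (Fin M)).Nonempty := ⟨m, Finset.mem_univ _⟩
  set S := {t : ℝ | k ≤ (Finset.univ.filter fun m => t ≤ v m).card} with hS
  have hbdd : BddAbove S := by
    refine ⟨Finset.univ.sup' hM v, fun t ht => ?_⟩
    obtain ⟨j, hj⟩ := Finset.card_pos.1 (lt_of_lt_of_le hk ht)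
    exact (Finset.mem_filter.1 hj).2.trans (Finset.le_sup' v (Finset.mem_univ j))
  have hne : S.Nonempty := by
    refine ⟨Finset.univ.inf' hM v, ?_⟩
    have : (Finset.univ.filter fun j => Finset.univ.inf' hM v ≤ v j) = Finset.univ :=
      Finset.filter_true_of_mem fun j _ => Finset.inf'_le v (Finset.mem_univ j)
    simp only [hS, Set.mem_ofPred_eq, this]
    simpa using hkM
  constructor
  · intro h
    by_contra! hc
    have hF : (Finset.univ.filter fun m' => v m < v m').Nonempty :=
      Finset.card_pos.1 (lt_of_lt_of_le hk hc)
    have ht : (Finset.univ.filter fun m' => v m < v m').inf' hF v ∈ S := by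
      refine hc.trans (Finset.card_le_card fun j hj => ?_)
      exact Finset.mem_filter.2 ⟨Finset.mem_univ j, Finset.inf'_le v hj⟩
    have h1 : v m < (Finset.univ.filter fun m' => v m < v m').inf' hF v := by
      rw [Finset.lt_inf'_iff]
      exact fun j hj => (Finset.mem_filter.1 hj).2
    exact absurd ((le_csSup hbdd ht).trans h) (not_le.2 h1)
  · intro h
    refine csSup_le hne fun t ht => ?_
    by_contra! hlt
    refine absurd (le_trans ht (Finset.card_le_card fun j hj => ?_)) (not_le.2 h)
    exact Finset.mem_filter.2 ⟨Finset.mem_univ j, hlt.trans_le (Finset.mem_filter.1 hj).2⟩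

/-- The direction `‖x‖⁻¹ • x` of a vector, with value `0` at `x = 0`. -/
noncomputable def unitDir {p : ℕ} (x : EuclideanSpace ℝ (Fin p)) : EuclideanSpace ℝ (Fin p) :=
  ‖x‖⁻¹ • x

section Cones

variable {p n M k : ℕ}

lemma norm_unitDir {x : EuclideanSpace ℝ (Fin p)} (hx : x ≠ 0) : ‖unitDir x‖ = 1 := by
  rw [unitDir, norm_smul, norm_inv, norm_norm, inv_mul_cancel₀ (norm_ne_zero_iff.2 hx)]

lemma norm_smul_unitDir (x : EuclideanSpace ℝ (Fin p)) : ‖x‖ • unitDir x = x := by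
  rcases eq_or_ne x 0 with rfl | hx
  · simp
  · rw [unitDir, smul_smul, mul_inv_cancel₀ (norm_ne_zero_iff.2 hx), one_smul]

lemma unitDir_smul {a : ℝ} (ha : 0 < a) (x : EuclideanSpace ℝ (Fin p)) :
    unitDir (a • x) = unitDir x := by
  rw [unitDir, unitDir, norm_smul, smul_smul, Real.norm_of_nonneg ha.le]
  congr 1; field_simp

lemma measurable_unitDir : Measurable (unitDir : EuclideanSpace ℝ (Fin p) → _) := by
  unfold unitDir; fun_prop

/-- The observations having `θ m` among their `k` nearest directions, as a function of the
directions `u` of the observations alone. -/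
noncomputable def nearIndices (k : ℕ) (u : Fin n → EuclideanSpace ℝ (Fin p))
    (θ : Fin M → EuclideanSpace ℝ (Fin p)) (m : Fin M) : Finset (Fin n) :=
  Finset.univ.filter fun i =>
    (Finset.univ.filter fun m' => inner ℝ (u i) (θ m) < inner ℝ (u i) (θ m')).card < k

/-- The selection step of the algorithm does not see the lengths of the observations. -/
lemma coneIndices_eq_nearIndices (X : Fin (n + M) → EuclideanSpace ℝ (Fin p))
    (hX : ∀ j, X j ≠ 0) (hk : 1 ≤ ⌊Real.log n⌋₊) (hkM : ⌊Real.log n⌋₊ ≤ M) (m : Fin M) :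
    coneIndices X m = nearIndices ⌊Real.log n⌋₊ (fun i => unitDir (X (Fin.castAdd M i)))
      (fun m => unitDir (X (Fin.natAdd n m))) m := by
  ext i
  simp only [coneIndices, nearIndices, Finset.mem_filter, Finset.mem_univ, true_and]
  rw [kthMax_le_iff hk hkM (fun m' => inner ℝ (X (Fin.castAdd M i)) (direction X m')) m]
  have hpos : 0 < ‖X (Fin.castAdd M i)‖ := norm_pos_iff.2 (hX _)
  have : ∀ y, inner ℝ (X (Fin.castAdd M i)) y
      = ‖X (Fin.castAdd M i)‖ * inner ℝ (unitDir (X (Fin.castAdd M i))) y := by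
    intro y
    rw [← real_inner_smul_left, norm_smul_unitDir]
  simp only [this, mul_lt_mul_iff_right₀ hpos]
  rfl

lemma inner_eq_of_unit {x y : EuclideanSpace ℝ (Fin p)} (hx : ‖x‖ = 1) (hy : ‖y‖ = 1) :
    inner ℝ x y = 1 - ‖x - y‖ ^ 2 / 2 := by
  have := norm_sub_sq_real x y
  rw [hx, hy] at this
  linarith

variable {u : Fin n → EuclideanSpace ℝ (Fin p)} {θ : Fin M → EuclideanSpace ℝ (Fin p)}

/-- For unit vectors the order of inner products is the reverse order of distances. -/
lemma mem_nearIndices_iff (hu : ∀ i, ‖u i‖ = 1) (hθ : ∀ m, ‖θ m‖ = 1) (m : Fin M) (i : Fin n) :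
    i ∈ nearIndices k u θ m ↔
      (Finset.univ.filter fun m' => ‖θ m' - u i‖ < ‖θ m - u i‖).card < k := by
  simp only [nearIndices, Finset.mem_filter, Finset.mem_univ, true_and]
  have : ∀ m', inner ℝ (u i) (θ m) < inner ℝ (u i) (θ m') ↔ ‖θ m' - u i‖ < ‖θ m - u i‖ := by
    intro m'
    rw [inner_eq_of_unit (hu i) (hθ m), inner_eq_of_unit (hu i) (hθ m'), norm_sub_rev (u i),
      norm_sub_rev (u i), ← sq_lt_sq₀ (norm_nonneg (θ m' - u i)) (norm_nonneg _)]
    constructor <;> intro h <;> linarith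
  simp only [this]

/-- If `k` directions lie within `δ` of `u i`, then `u i` is selected only by directions
within `δ`. -/
lemma norm_sub_le_of_mem_nearIndices (hu : ∀ i, ‖u i‖ = 1) (hθ : ∀ m, ‖θ m‖ = 1) {δ : ℝ}
    {m : Fin M} {i : Fin n} (hi : i ∈ nearIndices k u θ m)
    (hδ : k ≤ (Finset.univ.filter fun m' => ‖θ m' - u i‖ ≤ δ).card) : ‖θ m - u i‖ ≤ δ := by
  rw [mem_nearIndices_iff hu hθ] at hi
  by_contra! h
  refine absurd (hδ.trans (Finset.card_le_card fun j hj => ?_)) (not_le.2 hi)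
  exact Finset.mem_filter.2 ⟨Finset.mem_univ j, (Finset.mem_filter.1 hj).2.trans_lt h⟩

/-- If at most `k` directions lie within `2η` of `θ m`, then `θ m` selects every observation
within `η`: a direction closer to it than `θ m` would be another one of those. -/
lemma filter_subset_nearIndices (hu : ∀ i, ‖u i‖ = 1) (hθ : ∀ m, ‖θ m‖ = 1) {η : ℝ}
    {m : Fin M} (hη : (Finset.univ.filter fun m' => ‖θ m' - θ m‖ ≤ 2 * η).card ≤ k) :
    (Finset.univ.filter fun i => ‖u i - θ m‖ ≤ η) ⊆ nearIndices k u θ m := by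
  intro i hi
  rw [Finset.mem_filter, norm_sub_rev] at hi
  rw [mem_nearIndices_iff hu hθ]
  refine lt_of_lt_of_le (Finset.card_lt_card ?_) hη
  have hη0 : 0 ≤ η := (norm_nonneg _).trans hi.2
  refine (Finset.ssubset_iff_of_subset fun j hj => ?_).2 ⟨m, ?_, ?_⟩
  · rw [Finset.mem_filter] at hj ⊢
    refine ⟨Finset.mem_univ j, ?_⟩
    have : θ j - θ m = (θ j - u i) - (θ m - u i) := by abel
    rw [this]
    linarith [norm_sub_le (θ j - u i) (θ m - u i), hj.2, hi.2]
  · simp [hη0]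
  · simp

end Cones

/-! ### From radii and directions to the convex hull -/

section Sandwich

variable {p M : ℕ} {K : Set (EuclideanSpace ℝ (Fin p))} {r₁ r₂ : ℝ}

/-- Points near the boundary of `K`, in directions that are `δ`-dense on the sphere, span almost
all of `K`. Otherwise a linear functional separates a point of the shrunken body from the hull;
the direction nearest to its maximiser over `K` gives a hull point beyond the separating
hyperplane. -/
lemma smul_subset_convexHull [Nonempty (Fin M)] (hK : IsBodyAroundZero K) (h₁ : 0 < r₁)
    (h₂ : r₁ ≤ r₂)
    (hb₁ : Metric.closedBall 0 r₁ ⊆ K) (hb₂ : K ⊆ Metric.closedBall 0 r₂)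
    {θ : Fin M → EuclideanSpace ℝ (Fin p)} (hθ : ∀ m, ‖θ m‖ = 1) {t : Fin M → ℝ} {a δ : ℝ}
    (ha : a ≤ 1) (hδ : 0 ≤ δ) (hδ1 : r₂ / r₁ * δ ≤ 1)
    (hdense : ∀ u : EuclideanSpace ℝ (Fin p), ‖u‖ = 1 → ∃ m, ‖θ m - u‖ ≤ δ)
    (ht : ∀ m, 1 - a ≤ t m * gauge K (θ m)) :
    ((1 - a) * (1 - r₂ / r₁ * δ) / (1 + r₂ / r₁ * δ)) • K ⊆
      convexHull ℝ (Set.range fun m => t m • θ m) := by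
  set β := r₂ / r₁ * δ with hβ
  have hr₂ : 0 < r₂ := h₁.trans_le h₂
  have hβ0 : 0 ≤ β := by positivity
  set c := (1 - a) * (1 - β) / (1 + β) with hc
  have hc0 : 0 ≤ c := by
    have := sub_nonneg.2 ha
    have := sub_nonneg.2 hδ1
    positivity
  rintro _ ⟨x, hx, rfl⟩
  by_contra hnot
  obtain ⟨f, s, hf1, hf2⟩ := geometric_hahn_banach_closed_point (convex_convexHull ℝ _)
    ((Set.finite_range fun m => t m • θ m).isCompact_convexHull ℝ).isClosed hnot
  obtain ⟨v, hvK, hv⟩ := hK.isCompact.exists_isMaxOn ⟨0, hK.zero_mem⟩ f.continuous.continuousOn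
  -- `f` is the inner product with a vector `w`
  obtain ⟨w, rfl⟩ := (InnerProductSpace.toDual ℝ (EuclideanSpace ℝ (Fin p))).surjective f
  simp only [isMaxOn_iff, InnerProductSpace.toDual_apply_apply] at hf1 hf2 hv
  have hw : w ≠ 0 := by
    rintro rfl
    have := hf1 _ (subset_convexHull ℝ _ ⟨Classical.arbitrary (Fin M), rfl⟩)
    simp only [inner_zero_left] at this hf2
    linarith
  have hwpos : 0 < ‖w‖ := norm_pos_iff.2 hw
  have hwv : r₁ * ‖w‖ ≤ inner ℝ w v := by
    have hmem : r₁ • unitDir w ∈ K := hb₁ (by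
      rw [mem_closedBall_zero_iff, norm_smul, norm_unitDir hw, Real.norm_of_nonneg h₁.le, mul_one])
    have h := hv _ hmem
    have h' : inner ℝ w (r₁ • unitDir w) = r₁ * ‖w‖ := by
      rw [unitDir, inner_smul_right, inner_smul_right, real_inner_self_eq_norm_sq]
      field_simp
    rwa [h'] at h
  have hv0 : v ≠ 0 := by
    rintro rfl
    rw [inner_zero_right] at hwv
    exact absurd hwv (not_le.2 (by positivity))
  have hvpos : 0 < ‖v‖ := norm_pos_iff.2 hv0
  have hv2 : ‖v‖ ≤ r₂ := mem_closedBall_zero_iff.1 (hb₂ hvK)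
  obtain ⟨m, hm⟩ := hdense _ (norm_unitDir hv0)
  set h := inner ℝ w v with hh
  have hh0 : 0 < h := lt_of_lt_of_le (by positivity) hwv
  have hinner : h / ‖v‖ * (1 - β) ≤ inner ℝ w (θ m) := by
    have e1 : inner ℝ w (unitDir v) = h / ‖v‖ := by
      rw [unitDir, inner_smul_right, ← hh]; ring
    have e2 : inner ℝ w (unitDir v) - inner ℝ w (θ m) ≤ ‖w‖ * δ := by
      rw [← inner_sub_right]
      refine (real_inner_le_norm _ _).trans ?_
      rw [norm_sub_rev]
      gcongr
    have e3 : ‖w‖ * δ ≤ h / ‖v‖ * β := by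
      calc ‖w‖ * δ = (r₁ * ‖w‖) / r₂ * β := by rw [hβ]; field_simp
        _ ≤ h / ‖v‖ * β := by gcongr
    linarith
  have hgauge : gauge K (θ m) ≤ (1 + β) / ‖v‖ := by
    refine (hK.gauge_le_mul_of_unit h₁ hr₂ hb₁ hb₂ hm (norm_unitDir hv0)).trans ?_
    rw [div_eq_mul_inv (1 + β)]
    refine mul_le_mul_of_nonneg_left ?_ (by positivity)
    rw [unitDir, IsBodyAroundZero.gauge_smul (by positivity)]
    exact mul_le_of_le_one_right (by positivity) (gauge_le_one_of_mem hvK)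
  have hθ0 : θ m ≠ 0 := norm_ne_zero_iff.1 (by rw [hθ m]; exact one_ne_zero)
  have htm : (1 - a) * ‖v‖ / (1 + β) ≤ t m := by
    have hg := hK.gauge_pos hθ0
    have : (1 - a) / gauge K (θ m) ≤ t m := by
      rw [div_le_iff₀ hg]; exact ht m
    refine le_trans ?_ this
    rw [mul_div_assoc, div_eq_mul_inv (1 - a)]
    have := sub_nonneg.2 ha
    gcongr
    rw [le_inv_comm₀ (by positivity) hg, inv_div]
    exact hgauge
  have key : c * h ≤ inner ℝ w (t m • θ m) := by
    rw [inner_smul_right]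
    have := sub_nonneg.2 ha
    have := sub_nonneg.2 hδ1
    calc c * h = ((1 - a) * ‖v‖ / (1 + β)) * (h / ‖v‖ * (1 - β)) := by rw [hc]; field_simp
      _ ≤ t m * inner ℝ w (θ m) :=
        mul_le_mul htm hinner (by positivity) (le_trans (by positivity) htm)
  have h1 := hf1 _ (subset_convexHull ℝ _ ⟨m, rfl⟩)
  rw [inner_smul_right] at hf2
  have h2 : c * inner ℝ w x ≤ c * h := mul_le_mul_of_nonneg_left (hv x hx) hc0
  linarith

/-- The two inclusions defining `dScale`, for a hull spanned by approximate boundary points. -/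
lemma dScale_convexHull_le [Nonempty (Fin M)] (hK : IsBodyAroundZero K) (h₁ : 0 < r₁)
    (h₂ : r₁ ≤ r₂) (hb₁ : Metric.closedBall 0 r₁ ⊆ K) (hb₂ : K ⊆ Metric.closedBall 0 r₂)
    {θ : Fin M → EuclideanSpace ℝ (Fin p)} (hθ : ∀ m, ‖θ m‖ = 1) {t : Fin M → ℝ} {a δ ε : ℝ}
    (ha : a ≤ 1 / 4) (hδ : 0 ≤ δ) (hδ1 : r₂ / r₁ * δ ≤ 1 / 8)
    (hdense : ∀ u : EuclideanSpace ℝ (Fin p), ‖u‖ = 1 → ∃ m, ‖θ m - u‖ ≤ δ)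
    (ht0 : ∀ m, 0 ≤ t m)
    (ht : ∀ m, 1 - a ≤ t m * gauge K (θ m)) (ht' : ∀ m, t m * gauge K (θ m) ≤ 1 + a)
    (hε : 2 * a + 4 * (r₂ / r₁ * δ) ≤ ε) (hε0 : 0 < ε) :
    dScale (convexHull ℝ (Set.range fun m => t m • θ m)) K ≤ ENNReal.ofReal ε := by
  have ha0 : 0 ≤ a := by
    have := ht (Classical.arbitrary _)
    have := ht' (Classical.arbitrary _)
    linarith
  have hβ0 : 0 ≤ r₂ / r₁ * δ := by
    have := h₁.trans_le h₂
    positivity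
  refine iInf₂_le_of_le ε ⟨hε0, ?_, ?_⟩ le_rfl
  · rw [Set.smul_set_subset_iff₀ (by positivity)]
    have hpos : 0 < (1 / (1 + ε))⁻¹ := by positivity
    refine convexHull_min ?_ (hK.convex.smul _)
    rintro _ ⟨m, rfl⟩
    refine hK.mem_smul_of_gauge_le hpos ?_
    rw [IsBodyAroundZero.gauge_smul (ht0 m), one_div, inv_inv]
    linarith [ht' m]
  · have hsub := smul_subset_convexHull hK h₁ h₂ hb₁ hb₂ hθ (by linarith) hδ (by linarith)
      hdense ht
    set β := r₂ / r₁ * δ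
    set c := (1 - a) * (1 - β) / (1 + β) with hc
    have hc0 : 0 < c := by
      have : 0 < 1 - a := by linarith
      have : 0 < 1 - β := by linarith
      positivity
    have hce : 1 ≤ (1 + ε) * c := by
      have h3 : 1 + β ≤ (1 + (2 * a + 4 * β)) * ((1 - a) * (1 - β)) := by
        nlinarith [mul_nonneg ha0 hβ0, mul_nonneg ha0 (mul_nonneg ha0 hβ0),
          mul_nonneg hβ0 (mul_nonneg ha0 hβ0), mul_nonneg ha0 (sub_nonneg.2 ha),
          mul_nonneg hβ0 (sub_nonneg.2 hδ1), mul_nonneg hβ0 (sub_nonneg.2 ha)]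
      have h4 : 0 ≤ (1 - a) * (1 - β) := mul_nonneg (by linarith) (by linarith)
      rw [hc, ← mul_div_assoc, one_le_div (by positivity)]
      exact h3.trans (mul_le_mul_of_nonneg_right (by linarith) h4)
    intro x hx
    rw [Set.mem_smul_set_iff_inv_smul_mem₀ (by positivity)]
    have hx' : (c * (1 + ε))⁻¹ • x ∈ K := by
      rw [← hK.gauge_le_one_iff, IsBodyAroundZero.gauge_smul (by positivity)]
      refine mul_le_one₀ (inv_le_one_of_one_le₀ (by linarith)) (gauge_nonneg x)
        (gauge_le_one_of_mem hx)
    have := hsub ⟨_, hx', rfl⟩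
    convert this using 1
    change _ = c • _
    rw [smul_smul]
    congr 1
    field_simp

end Sandwich

/-! ### Volumes of cones and caps -/

section Cone

variable {p : ℕ}

/-- Volume is homogeneous of degree `p` on the part of a cone cut off by a positively homogeneous
function. -/
lemma volume_cone_inter_lt {g : EuclideanSpace ℝ (Fin p) → ℝ}
    (hg : ∀ a : ℝ, 0 ≤ a → ∀ x, g (a • x) = a * g x) (B : Set (EuclideanSpace ℝ (Fin p)))
    {r : ℝ} (hr : 0 < r) :
    volume (unitDir ⁻¹' B ∩ {x | g x < r}) =
      ENNReal.ofReal (r ^ p) * volume (unitDir ⁻¹' B ∩ {x | g x < 1}) := by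
  have : unitDir ⁻¹' B ∩ {x | g x < r} = r • (unitDir ⁻¹' B ∩ {x | g x < 1}) := by
    ext x
    rw [Set.mem_smul_set_iff_inv_smul_mem₀ hr.ne']
    simp only [Set.mem_inter_iff, Set.mem_preimage, Set.mem_ofPred_eq]
    rw [unitDir_smul (inv_pos.2 hr), hg _ (inv_pos.2 hr).le, inv_mul_lt_iff₀ hr, mul_one]
  rw [this, Measure.addHaar_smul_of_nonneg _ hr.le, finrank_euclideanSpace_fin]

/-- The cap of directions within `r` of `u`, seen as a cone. -/
def capCone (u : EuclideanSpace ℝ (Fin p)) (r : ℝ) : Set (EuclideanSpace ℝ (Fin p)) :=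
  {x | ‖unitDir x - u‖ ≤ r}

lemma capCone_eq (u : EuclideanSpace ℝ (Fin p)) (r : ℝ) :
    capCone u r = unitDir ⁻¹' {y | ‖y - u‖ ≤ r} := rfl

lemma measurableSet_capCone (u : EuclideanSpace ℝ (Fin p)) (r : ℝ) :
    MeasurableSet (capCone u r) :=
  measurableSet_le ((measurable_unitDir.sub_const u).norm) measurable_const

lemma volume_real_ball_eq (x : EuclideanSpace ℝ (Fin p)) {r : ℝ} (hr : 0 < r) :
    volume.real (Metric.ball x r)
      = r ^ p * volume.real (Metric.ball (0 : EuclideanSpace ℝ (Fin p)) 1) := by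
  rw [Measure.real, Measure.addHaar_ball_of_pos _ _ hr, ENNReal.toReal_mul,
    ENNReal.toReal_ofReal (by positivity), finrank_euclideanSpace_fin, Measure.real]

lemma volume_real_unitBall_pos :
    0 < volume.real (Metric.ball (0 : EuclideanSpace ℝ (Fin p)) 1) :=
  ENNReal.toReal_pos (Metric.measure_ball_pos _ _ one_pos).ne' measure_ball_lt_top.ne

lemma ball_subset_capCone {u : EuclideanSpace ℝ (Fin p)} (hu : ‖u‖ = 1) {r s : ℝ}
    (hr : 0 < r) (hr1 : r ≤ 1) (hs : 1 / 2 ≤ s) (hs' : s ≤ 3 / 4) :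
    Metric.ball (s • u) (r / 8) ⊆ capCone u r ∩ Metric.ball 0 1 := by
  intro x hx
  rw [Metric.mem_ball, dist_eq_norm] at hx
  have hsu : ‖s • u‖ = s := by rw [norm_smul, hu, mul_one, Real.norm_of_nonneg (by linarith)]
  have h1 : |‖x‖ - s| < r / 8 := by
    have := abs_norm_sub_norm_le x (s • u)
    rw [hsu] at this
    linarith
  obtain ⟨h2, h3⟩ := abs_lt.1 h1
  have hx0 : 0 < ‖x‖ := by linarith
  refine ⟨?_, by rw [mem_ball_zero_iff]; linarith⟩
  have h4 : ‖x - ‖x‖ • u‖ ≤ r / 4 := by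
    have e : x - ‖x‖ • u = (x - s • u) - (‖x‖ - s) • u := by rw [sub_smul]; abel
    rw [e]
    refine (norm_sub_le _ _).trans ?_
    rw [norm_smul, hu, mul_one, Real.norm_eq_abs]
    linarith
  have h5 : unitDir x - u = ‖x‖⁻¹ • (x - ‖x‖ • u) := by
    rw [smul_sub, smul_smul, inv_mul_cancel₀ hx0.ne', one_smul]; rfl
  change ‖unitDir x - u‖ ≤ r
  rw [h5, norm_smul, norm_inv, norm_norm, inv_mul_le_iff₀ hx0]
  nlinarith

/-- Caps of radius `r` have solid angle at least of order `r ^ (p - 1)`: the cone contains about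
`1 / r` disjoint balls of radius `r / 8` along its axis. -/
lemma le_volume_capCone (hp : 1 ≤ p) {u : EuclideanSpace ℝ (Fin p)} (hu : ‖u‖ = 1) {r : ℝ}
    (hr : 0 < r) (hr1 : r ≤ 1) :
    (8⁻¹ : ℝ) ^ p * r ^ (p - 1) * volume.real (Metric.ball (0 : EuclideanSpace ℝ (Fin p)) 1) ≤
      volume.real (capCone u r ∩ Metric.ball 0 1) := by
  set J := ⌈1 / r⌉₊
  set s : ℕ → ℝ := fun j => 1 / 2 + j * (r / 4) with hs
  have hJ : 1 / r ≤ J := Nat.le_ceil _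
  have hball : ∀ j ∈ Finset.range J, Metric.ball (s j • u) (r / 8) ⊆
      capCone u r ∩ Metric.ball 0 1 := by
    intro j hj
    have hj : (j : ℝ) < 1 / r := Nat.lt_ceil.1 (Finset.mem_range.1 hj)
    have : (j : ℝ) * r < 1 := by rwa [lt_div_iff₀ hr] at hj
    have h0 : (0 : ℝ) ≤ j * r := by positivity
    exact ball_subset_capCone hu hr hr1 (by simp only [hs]; linarith) (by simp only [hs]; linarith)
  have hdisj : (Finset.range J : Set ℕ).PairwiseDisjoint
      fun j => Metric.ball (s j • u) (r / 8) := by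
    intro i _ j _ hij
    refine Metric.ball_disjoint_ball ?_
    rw [dist_eq_norm, ← sub_smul, norm_smul, hu, mul_one, Real.norm_eq_abs]
    have : s i - s j = ((i : ℝ) - j) * (r / 4) := by simp only [hs]; ring
    rw [this, abs_mul, abs_of_pos (by positivity : 0 < r / 4)]
    have : (1 : ℝ) ≤ |(i : ℝ) - j| := by
      have h : (1 : ℤ) ≤ |(i : ℤ) - j| := Int.one_le_abs (sub_ne_zero.2 (by exact_mod_cast hij))
      exact_mod_cast h
    nlinarith
  have hfin : volume (capCone u r ∩ Metric.ball 0 1) ≠ ⊤ :=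
    measure_ne_top_of_subset Set.inter_subset_right measure_ball_lt_top.ne
  have h := measureReal_mono (μ := volume) (Set.iUnion₂_subset hball) hfin
  rw [measureReal_biUnion_finset hdisj (fun _ _ => Metric.isOpen_ball.measurableSet)
    (fun j _ => measure_ball_lt_top.ne)] at h
  refine le_trans ?_ h
  simp only [volume_real_ball_eq _ (by positivity : 0 < r / 8), Finset.sum_const,
    Finset.card_range, nsmul_eq_mul]
  obtain ⟨q, rfl⟩ : ∃ q, p = q + 1 := ⟨p - 1, by omega⟩
  have hω := volume_real_unitBall_pos (p := q + 1)
  calc _ = (1 / r) * ((r / 8) ^ (q + 1) * volume.real (Metric.ball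
        (0 : EuclideanSpace ℝ (Fin (q + 1))) 1)) := by
        rw [Nat.add_sub_cancel, div_eq_mul_inv r 8, mul_pow, pow_succ r q]; field_simp
    _ ≤ _ := by gcongr

/-- Caps of radius `r` have solid angle at most of order `r ^ (p - 1)`: the cone is covered by
about `1 / r` balls of radius `3 * r` along its axis. -/
lemma volume_capCone_le (hp : 1 ≤ p) {u : EuclideanSpace ℝ (Fin p)} (hu : ‖u‖ = 1) {r : ℝ}
    (hr : 0 < r) (hr1 : r ≤ 1) :
    volume.real (capCone u r ∩ Metric.ball 0 1) ≤
      (3 : ℝ) ^ (p + 1) * r ^ (p - 1)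
        * volume.real (Metric.ball (0 : EuclideanSpace ℝ (Fin p)) 1) := by
  set J := ⌊1 / r⌋₊ + 1 with hJ
  have hsub : capCone u r ∩ Metric.ball 0 1 ⊆
      ⋃ j ∈ Finset.range J, Metric.ball (((j : ℝ) * r) • u) (3 * r) := by
    rintro x ⟨hx, hx1⟩
    rw [mem_ball_zero_iff] at hx1
    have hle : (⌊‖x‖ / r⌋₊ : ℝ) ≤ ‖x‖ / r := Nat.floor_le (by positivity)
    have hlt : ‖x‖ / r < ⌊‖x‖ / r⌋₊ + 1 := Nat.lt_floor_add_one _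
    rw [le_div_iff₀ hr] at hle
    rw [div_lt_iff₀ hr] at hlt
    refine Set.mem_iUnion₂.2 ⟨⌊‖x‖ / r⌋₊, ?_, ?_⟩
    · rw [Finset.mem_range, hJ]
      exact Nat.lt_succ_of_le (Nat.floor_le_floor (by gcongr))
    · rw [Metric.mem_ball, dist_eq_norm]
      have e : x - ((⌊‖x‖ / r⌋₊ : ℝ) * r) • u
          = ‖x‖ • (unitDir x - u) + (‖x‖ - (⌊‖x‖ / r⌋₊ : ℝ) * r) • u := by
        rw [smul_sub, norm_smul_unitDir, sub_smul]; abel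
      rw [e]
      refine (norm_add_le _ _).trans_lt ?_
      rw [norm_smul, norm_smul, hu, norm_norm, mul_one, Real.norm_of_nonneg (by linarith)]
      have : ‖x‖ * ‖unitDir x - u‖ ≤ 1 * r := by
        gcongr
        exact hx
      linarith
  have hfin : volume (⋃ j ∈ Finset.range J,
      Metric.ball (((j : ℝ) * r) • u) (3 * r)) ≠ ⊤ :=
    (measure_biUnion_lt_top (Finset.finite_toSet _) fun _ _ => measure_ball_lt_top).ne
  refine (measureReal_mono hsub hfin).trans ((measureReal_biUnion_finset_le _ _).trans ?_)
  simp only [volume_real_ball_eq _ (by positivity : 0 < 3 * r), Finset.sum_const,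
    Finset.card_range, nsmul_eq_mul]
  obtain ⟨q, rfl⟩ : ∃ q, p = q + 1 := ⟨p - 1, by omega⟩
  have hω := volume_real_unitBall_pos (p := q + 1)
  have hJr : (J : ℝ) ≤ 3 / r := by
    rw [hJ, Nat.cast_add, Nat.cast_one]
    have h1 : (⌊1 / r⌋₊ : ℝ) ≤ 1 / r := Nat.floor_le (by positivity)
    have h2 : 1 ≤ 1 / r := by rwa [le_div_iff₀ hr, one_mul]
    have h3 : 3 / r = 3 * (1 / r) := by ring
    linarith
  calc _ ≤ (3 / r) * ((3 * r) ^ (q + 1) * volume.real (Metric.ball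
        (0 : EuclideanSpace ℝ (Fin (q + 1))) 1)) := by gcongr
    _ = _ := by rw [Nat.add_sub_cancel, mul_pow, pow_succ r q, pow_succ 3 (q + 1)]; field_simp

/-- A net of the unit sphere with polynomially many points, obtained from a maximal separated
set and a volume comparison. -/
lemma exists_sphere_net (p : ℕ) {r : ℝ} (hr : 0 < r) (hr1 : r ≤ 1) :
    ∃ T : Finset (EuclideanSpace ℝ (Fin p)), (∀ v ∈ T, ‖v‖ = 1) ∧
      (T.card : ℝ) ≤ (4 / r) ^ p ∧
      ∀ u : EuclideanSpace ℝ (Fin p), ‖u‖ = 1 → ∃ v ∈ T, ‖u - v‖ ≤ r := by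
  classical
  let S : Finset (EuclideanSpace ℝ (Fin p)) → Prop := fun T =>
    (∀ v ∈ T, ‖v‖ = 1) ∧ ∀ v ∈ T, ∀ w ∈ T, v ≠ w → r < ‖v - w‖
  have hbound : ∀ T, S T → (T.card : ℝ) ≤ (4 / r) ^ p := by
    intro T hT
    have hdisj : (T : Set (EuclideanSpace ℝ (Fin p))).PairwiseDisjoint
        fun v => Metric.ball v (r / 2) := by
      intro v hv w hw hvw
      refine Metric.ball_disjoint_ball ?_
      rw [dist_eq_norm]
      linarith [hT.2 v hv w hw hvw]
    have hsub : (⋃ v ∈ T, Metric.ball v (r / 2)) ⊆ Metric.ball 0 2 := by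
      refine Set.iUnion₂_subset fun v hv => Metric.ball_subset_ball' ?_
      rw [dist_zero_right, hT.1 v hv]
      linarith
    have h := measureReal_mono (μ := volume) hsub measure_ball_lt_top.ne
    rw [measureReal_biUnion_finset hdisj (fun _ _ => Metric.isOpen_ball.measurableSet)
      (fun j _ => measure_ball_lt_top.ne)] at h
    simp only [volume_real_ball_eq _ (by positivity : 0 < r / 2), Finset.sum_const,
      nsmul_eq_mul, volume_real_ball_eq _ (by positivity : (0 : ℝ) < 2)] at h
    rw [← mul_assoc] at h
    have h' := le_of_mul_le_mul_right h volume_real_unitBall_pos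
    rw [← le_div_iff₀ (by positivity), ← div_pow] at h'
    rwa [show (2 : ℝ) / (r / 2) = 4 / r by field_simp; norm_num] at h'
  -- a separated set of maximal cardinality is a net
  obtain ⟨T, hT, hmax⟩ : ∃ T, S T ∧ ∀ T', S T' → T'.card ≤ T.card := by
    by_contra! hcon
    have : ∀ k : ℕ, ∃ T, S T ∧ k ≤ T.card := by
      intro k
      induction k with
      | zero => exact ⟨∅, ⟨by simp, by simp⟩, by simp⟩
      | succ k ih =>
        obtain ⟨T, hT, hk⟩ := ih
        obtain ⟨T', hT', hlt⟩ := hcon T hT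
        exact ⟨T', hT', by omega⟩
    obtain ⟨T, hT, hk⟩ := this (⌊(4 / r) ^ p⌋₊ + 1)
    have := hbound T hT
    have h2 := Nat.lt_floor_add_one ((4 / r) ^ p)
    have h3 : ((⌊(4 / r) ^ p⌋₊ + 1 : ℕ) : ℝ) ≤ T.card := by exact_mod_cast hk
    push_cast at h3
    linarith
  refine ⟨T, hT.1, hbound T hT, fun u hu => ?_⟩
  by_contra! hfar
  have hu' : u ∉ T := fun h => by
    have := hfar u h
    simp at this
    linarith
  have hS : S (insert u T) := by
    constructor
    · intro v hv
      rcases Finset.mem_insert.1 hv with rfl | hv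
      exacts [hu, hT.1 v hv]
    · intro v hv w hw hvw
      rcases Finset.mem_insert.1 hv with hv' | hv' <;>
        rcases Finset.mem_insert.1 hw with hw' | hw'
      · exact absurd (hv'.trans hw'.symm) hvw
      · rw [hv']; exact hfar w hw'
      · rw [hw', norm_sub_rev]; exact hfar v hv'
      · exact hT.2 v hv' w hw' hvw
  have := hmax _ hS
  rw [Finset.card_insert_of_notMem hu'] at this
  omega

end Cone

/-! ### Independence of the gauge and the direction -/

section Law

variable {p : ℕ} {K : Set (EuclideanSpace ℝ (Fin p))}

lemma IsBodyAroundZero.volume_gauge_lt_pos (hK : IsBodyAroundZero K) :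
    0 < volume {x | gauge K x < 1} := by
  refine IsOpen.measure_pos _ (isOpen_lt hK.continuous_gauge continuous_const) ⟨0, ?_⟩
  simp

lemma IsBodyAroundZero.volume_gauge_lt_ne_top (hK : IsBodyAroundZero K) :
    volume {x | gauge K x < 1} ≠ ⊤ :=
  measure_ne_top_of_subset (fun x hx => (hK.gauge_le_one_iff x).1 (le_of_lt hx))
    hK.isCompact.measure_lt_top.ne

/-- The image under the gauge of the volume of a cone depends on the cone only through a
factor, since both images are homogeneous of degree `p`. -/
lemma map_gauge_restrict_cone (hK : IsBodyAroundZero K) {B : Set (EuclideanSpace ℝ (Fin p))}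
    (hB : MeasurableSet B) :
    volume {x | gauge K x < 1} • (volume.restrict (unitDir ⁻¹' B)).map (gauge K) =
      volume (unitDir ⁻¹' B ∩ {x | gauge K x < 1}) • volume.map (gauge K) := by
  have hg := hK.continuous_gauge.measurable
  set F : Set (EuclideanSpace ℝ (Fin p)) → ℝ → ℝ≥0∞ :=
    fun B r => volume (unitDir ⁻¹' B ∩ {x | gauge K x < r}) with hF
  have hhom : ∀ (B) {r : ℝ}, 0 < r → F B r = ENNReal.ofReal (r ^ p) * F B 1 := fun B r hr =>
    volume_cone_inter_lt (fun a ha x => IsBodyAroundZero.gauge_smul ha x) B hr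
  have hfin1 : ∀ B, F B 1 ≠ ⊤ := fun B =>
    measure_ne_top_of_subset Set.inter_subset_right hK.volume_gauge_lt_ne_top
  have hzero : ∀ (B) {r : ℝ}, r ≤ 0 → F B r = 0 := by
    intro B r hr
    have : {x | gauge K x < r} = ∅ :=
      Set.eq_empty_of_forall_notMem fun x hx => absurd (hr.trans (gauge_nonneg x)) (not_le.2 hx)
    simp [hF, this]
  have hfin : ∀ B r, F B r ≠ ⊤ := by
    intro B r
    rcases le_or_gt r 0 with hr | hr
    · simp [hzero B hr]
    · rw [hhom B hr]; exact ENNReal.mul_ne_top ENNReal.ofReal_ne_top (hfin1 B)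
  have hprop : ∀ r, F Set.univ 1 * F B r = F B 1 * F Set.univ r := by
    intro r
    rcases le_or_gt r 0 with hr | hr
    · simp [hzero _ hr]
    · rw [hhom B hr, hhom Set.univ hr]; ring
  have huniv : volume {x | gauge K x < 1} = F Set.univ 1 := by simp [hF]
  have hIco : ∀ (B : Set (EuclideanSpace ℝ (Fin p))), MeasurableSet B → ∀ a b : ℝ, a < b →
      volume (gauge K ⁻¹' Set.Ico a b ∩ unitDir ⁻¹' B) = F B b - F B a := by
    intro B hB a b hab
    have hsub : {x | gauge K x < a} ⊆ {x | gauge K x < b} := fun x (hx : _ < a) => hx.trans hab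
    change _ = volume (unitDir ⁻¹' B ∩ {x | gauge K x < b})
      - volume (unitDir ⁻¹' B ∩ {x | gauge K x < a})
    rw [← measure_sdiff (Set.inter_subset_inter_right _ hsub)
      ((measurable_unitDir hB).inter (measurableSet_lt hg measurable_const)).nullMeasurableSet
      (hfin B a)]
    congr 1
    ext x
    simp only [Set.mem_inter_iff, Set.mem_preimage, Set.mem_Ico, Set.mem_sdiff, Set.mem_ofPred_eq,
      not_and, not_lt]
    tauto
  have hval1 : ∀ a b : ℝ, a < b →
      (volume.restrict (unitDir ⁻¹' B)).map (gauge K) (Set.Ico a b) = F B b - F B a := by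
    intro a b hab
    rw [Measure.map_apply hg measurableSet_Ico, Measure.restrict_apply (hg measurableSet_Ico),
      hIco B hB a b hab]
  have hval2 : ∀ a b : ℝ, a < b →
      volume.map (gauge K) (Set.Ico a b) = F Set.univ b - F Set.univ a := by
    intro a b hab
    rw [Measure.map_apply hg measurableSet_Ico, ← hIco Set.univ MeasurableSet.univ a b hab]
    simp
  refine Measure.ext_of_Ico' _ _ (fun a b hab => ?_) (fun a b hab => ?_)
  · rw [Measure.smul_apply, hval1 a b hab, huniv, smul_eq_mul]
    exact ENNReal.mul_ne_top (hfin1 _) (ENNReal.sub_ne_top (hfin B b))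
  · rw [Measure.smul_apply, Measure.smul_apply, hval1 a b hab, hval2 a b hab, huniv, smul_eq_mul,
      smul_eq_mul, ENNReal.mul_sub (fun _ _ => hfin1 _), ENNReal.mul_sub (fun _ _ => hfin1 _),
      hprop, hprop]

variable {h : ℝ → ℝ≥0∞}

lemma withDensity_gauge_cone (hK : IsBodyAroundZero K) (hh : Measurable h)
    {A : Set ℝ} (hA : MeasurableSet A) {B : Set (EuclideanSpace ℝ (Fin p))}
    (hB : MeasurableSet B) :
    volume {x | gauge K x < 1} *
        (volume.withDensity fun x => h (gauge K x)) (gauge K ⁻¹' A ∩ unitDir ⁻¹' B) =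
      volume (unitDir ⁻¹' B ∩ {x | gauge K x < 1}) *
        (volume.withDensity fun x => h (gauge K x)) (gauge K ⁻¹' A) := by
  have hg := hK.continuous_gauge.measurable
  have h1 : (volume.withDensity fun x => h (gauge K x)) (gauge K ⁻¹' A ∩ unitDir ⁻¹' B) =
      ∫⁻ r in A, h r ∂((volume.restrict (unitDir ⁻¹' B)).map (gauge K)) := by
    rw [withDensity_apply _ ((hg hA).inter (measurable_unitDir hB)), setLIntegral_map hA hh hg,
      Measure.restrict_restrict (hg hA)]
  have h2 : (volume.withDensity fun x => h (gauge K x)) (gauge K ⁻¹' A) =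
      ∫⁻ r in A, h r ∂(volume.map (gauge K)) := by
    rw [withDensity_apply _ (hg hA), setLIntegral_map hA hh hg]
  rw [h1, h2, ← smul_eq_mul, ← smul_eq_mul, ← lintegral_smul_measure, ← lintegral_smul_measure,
    ← Measure.restrict_smul, ← Measure.restrict_smul, map_gauge_restrict_cone hK hB]

lemma withDensity_gauge_unitDir (hK : IsBodyAroundZero K) (hh : Measurable h)
    [IsProbabilityMeasure (volume.withDensity fun x => h (gauge K x))]
    {B : Set (EuclideanSpace ℝ (Fin p))} (hB : MeasurableSet B) :
    volume {x | gauge K x < 1} *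
        (volume.withDensity fun x => h (gauge K x)) (unitDir ⁻¹' B) =
      volume (unitDir ⁻¹' B ∩ {x | gauge K x < 1}) := by
  simpa using withDensity_gauge_cone hK hh MeasurableSet.univ hB

/-- If the density is a function of the gauge, then gauge and direction are independent. -/
lemma indepFun_gauge_unitDir (hK : IsBodyAroundZero K) (hh : Measurable h)
    [IsProbabilityMeasure (volume.withDensity fun x => h (gauge K x))] :
    IndepFun (gauge K) unitDir (volume.withDensity fun x => h (gauge K x)) := by
  rw [indepFun_iff_measure_inter_preimage_eq_mul]
  intro A B hA hB
  refine (ENNReal.mul_right_inj hK.volume_gauge_lt_pos.ne' hK.volume_gauge_lt_ne_top).1 ?_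
  rw [withDensity_gauge_cone hK hh hA hB, ← withDensity_gauge_unitDir hK hh hB]
  ring

variable {r₁ r₂ : ℝ}

lemma volume_real_gauge_lt_le (hK : IsBodyAroundZero K) (h₂ : 0 < r₂)
    (hb₂ : K ⊆ Metric.closedBall 0 r₂) :
    volume.real {x | gauge K x < 1} ≤
      r₂ ^ p * volume.real (Metric.ball (0 : EuclideanSpace ℝ (Fin p)) 1) := by
  rw [← volume_real_ball_eq 0 h₂]
  refine measureReal_mono (fun x hx => ?_) measure_ball_lt_top.ne
  have := hK.norm_div_le_gauge h₂ hb₂ x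
  rw [div_le_iff₀ h₂] at this
  rw [mem_ball_zero_iff]
  exact this.trans_lt ((mul_lt_iff_lt_one_left h₂).2 hx)

lemma ball_subset_gauge_lt (h₁ : 0 < r₁) (hb₁ : Metric.closedBall 0 r₁ ⊆ K) :
    Metric.ball 0 r₁ ⊆ {x | gauge K x < 1} := by
  intro x hx
  rw [mem_ball_zero_iff] at hx
  exact (IsBodyAroundZero.gauge_le_norm_div h₁ hb₁ x).trans_lt ((div_lt_one h₁).2 hx)

lemma le_volume_real_gauge_lt (hK : IsBodyAroundZero K) (h₁ : 0 < r₁)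
    (hb₁ : Metric.closedBall 0 r₁ ⊆ K) :
    r₁ ^ p * volume.real (Metric.ball (0 : EuclideanSpace ℝ (Fin p)) 1) ≤
      volume.real {x | gauge K x < 1} := by
  rw [← volume_real_ball_eq 0 h₁]
  exact measureReal_mono (ball_subset_gauge_lt h₁ hb₁) hK.volume_gauge_lt_ne_top

lemma volume_real_capCone_inter_ball (u : EuclideanSpace ℝ (Fin p)) (s : ℝ) {r : ℝ}
    (hr : 0 < r) : volume.real (capCone u s ∩ Metric.ball 0 r)
      = r ^ p * volume.real (capCone u s ∩ Metric.ball 0 1) := by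
  have h := volume_cone_inter_lt (p := p) (g := fun x => ‖x‖)
    (fun a ha x => by rw [norm_smul, Real.norm_of_nonneg ha]) {y | ‖y - u‖ ≤ s} hr
  have hb : ∀ r : ℝ, {x : EuclideanSpace ℝ (Fin p) | ‖x‖ < r} = Metric.ball 0 r := by
    intro r; ext x; simp
  rw [hb, hb, ← capCone_eq] at h
  rw [Measure.real, h, ENNReal.toReal_mul, ENNReal.toReal_ofReal (by positivity), Measure.real]

lemma withDensity_gauge_capCone_real (hK : IsBodyAroundZero K) (hh : Measurable h)
    [IsProbabilityMeasure (volume.withDensity fun x => h (gauge K x))]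
    (u : EuclideanSpace ℝ (Fin p)) (s : ℝ) :
    volume.real {x | gauge K x < 1} *
        (volume.withDensity fun x => h (gauge K x)).real (capCone u s) =
      volume.real (capCone u s ∩ {x | gauge K x < 1}) := by
  have := withDensity_gauge_unitDir hK hh (B := {y | ‖y - u‖ ≤ s})
    (measurableSet_le (measurable_id.sub_const u).norm measurable_const)
  rw [← capCone_eq] at this
  simp only [Measure.real, ← ENNReal.toReal_mul, this]

/-- Caps have probability of order at least `r ^ (p - 1)`. -/
lemma le_prob_capCone (hp : 1 ≤ p) (hK : IsBodyAroundZero K) (hh : Measurable h)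
    [IsProbabilityMeasure (volume.withDensity fun x => h (gauge K x))]
    (h₁ : 0 < r₁) (h₂ : r₁ ≤ r₂)
    (hb₁ : Metric.closedBall 0 r₁ ⊆ K) (hb₂ : K ⊆ Metric.closedBall 0 r₂)
    {u : EuclideanSpace ℝ (Fin p)} (hu : ‖u‖ = 1) {r : ℝ} (hr : 0 < r) (hr1 : r ≤ 1) :
    (8 * (r₂ / r₁))⁻¹ ^ p * r ^ (p - 1) ≤
      (volume.withDensity fun x => h (gauge K x)).real (capCone u r) := by
  have hr₂ : 0 < r₂ := h₁.trans_le h₂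
  have hω := volume_real_unitBall_pos (p := p)
  have e1 := withDensity_gauge_capCone_real hK hh u r
  have e2 := volume_real_gauge_lt_le hK hr₂ hb₂
  have e3 : volume.real (capCone u r ∩ Metric.ball 0 r₁) ≤
      volume.real (capCone u r ∩ {x | gauge K x < 1}) :=
    measureReal_mono (Set.inter_subset_inter_right _ (ball_subset_gauge_lt h₁ hb₁))
      (measure_ne_top_of_subset Set.inter_subset_right hK.volume_gauge_lt_ne_top)
  rw [volume_real_capCone_inter_ball u r h₁, ← e1] at e3
  have e4 := le_volume_capCone hp hu hr hr1
  refine le_of_mul_le_mul_left ?_ (mul_pos (pow_pos hr₂ p) hω)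
  calc _ = r₁ ^ p * ((8 : ℝ)⁻¹ ^ p * r ^ (p - 1) *
          volume.real (Metric.ball (0 : EuclideanSpace ℝ (Fin p)) 1)) := by
        simp only [mul_inv, inv_div, mul_pow, div_pow]; field_simp
    _ ≤ _ := (mul_le_mul_of_nonneg_left e4 (by positivity)).trans
        (e3.trans (mul_le_mul_of_nonneg_right e2 measureReal_nonneg))

/-- Caps have probability of order at most `r ^ (p - 1)`. -/
lemma prob_capCone_le (hp : 1 ≤ p) (hK : IsBodyAroundZero K) (hh : Measurable h)
    [IsProbabilityMeasure (volume.withDensity fun x => h (gauge K x))]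
    (h₁ : 0 < r₁) (h₂ : r₁ ≤ r₂)
    (hb₁ : Metric.closedBall 0 r₁ ⊆ K) (hb₂ : K ⊆ Metric.closedBall 0 r₂)
    {u : EuclideanSpace ℝ (Fin p)} (hu : ‖u‖ = 1) {r : ℝ} (hr : 0 < r) (hr1 : r ≤ 1) :
    (volume.withDensity fun x => h (gauge K x)).real (capCone u r) ≤
      3 * (3 * (r₂ / r₁)) ^ p * r ^ (p - 1) := by
  have hr₂ : 0 < r₂ := h₁.trans_le h₂
  have hω := volume_real_unitBall_pos (p := p)
  have e1 := withDensity_gauge_capCone_real hK hh u r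
  have e2 := le_volume_real_gauge_lt hK h₁ hb₁
  have e3 : volume.real (capCone u r ∩ {x | gauge K x < 1}) ≤
      volume.real (capCone u r ∩ Metric.ball 0 r₂) := by
    refine measureReal_mono (Set.inter_subset_inter_right _ fun x hx => ?_)
      (measure_ne_top_of_subset Set.inter_subset_right measure_ball_lt_top.ne)
    have := hK.norm_div_le_gauge hr₂ hb₂ x
    rw [div_le_iff₀ hr₂] at this
    rw [mem_ball_zero_iff]
    exact this.trans_lt ((mul_lt_iff_lt_one_left hr₂).2 hx)
  rw [volume_real_capCone_inter_ball u r hr₂, ← e1] at e3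
  have e4 := volume_capCone_le hp hu hr hr1
  refine le_of_mul_le_mul_left ?_ (mul_pos (pow_pos h₁ p) hω)
  calc _ ≤ r₂ ^ p * ((3 : ℝ) ^ (p + 1) * r ^ (p - 1) *
          volume.real (Metric.ball (0 : EuclideanSpace ℝ (Fin p)) 1)) :=
        (mul_le_mul_of_nonneg_right e2 measureReal_nonneg).trans
          (e3.trans (mul_le_mul_of_nonneg_left e4 (by positivity)))
    _ = _ := by rw [mul_pow, div_pow, pow_succ]; field_simp

end Law

/-! ### The radial law -/

section Radial

/-- The profile `r ↦ exp (φ r)` of a generator, extended to the real line. -/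
noncomputable def profile (φ : ℝ≥0 → EReal) (r : ℝ) : ℝ≥0∞ := EReal.exp (φ r.toNNReal)

variable {φ : ℝ≥0 → EReal}

namespace IsGenerator

lemma antitone_profile (hφ : IsGenerator φ) : Antitone (profile φ) := fun _ _ h =>
  EReal.exp_monotone (hφ.antitone (Real.toNNReal_mono h))

lemma measurable_profile (hφ : IsGenerator φ) : Measurable (profile φ) :=
  hφ.antitone_profile.measurable

/-- Concavity along the segment from `0` to `r`, where `φ` takes real values `a` and `b`. -/
lemma le_apply_mul (hφ : IsGenerator φ) {a b : ℝ} (ha : φ 0 = a) {r : ℝ≥0} (hb : (b : EReal) ≤ φ r)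
    {l : ℝ≥0} (hl : 0 < l) (hl1 : l < 1) :
    (((1 - l) * a + l * b : ℝ) : EReal) ≤ φ (l * r) := by
  have hφr : φ r ≠ ⊤ := hφ.ne_top r
  have hφr' : φ r ≠ ⊥ := fun h => by rw [h] at hb; exact absurd hb (by simp)
  lift φ r to ℝ using ⟨hφr, hφr'⟩ with c hc
  have h := hφ.concave 0 r (1 - l) l (tsub_pos_of_lt hl1) hl (tsub_add_cancel_of_le hl1.le)
  rw [ha, ← hc, mul_zero, zero_add, NNReal.coe_sub hl1.le, NNReal.coe_one] at h
  refine le_trans ?_ h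
  rw [← EReal.coe_mul, ← EReal.coe_mul, ← EReal.coe_add, EReal.coe_le_coe_iff]
  have : b ≤ c := EReal.coe_le_coe_iff.1 hb
  gcongr

/-- If `φ` has dropped by at least `1` at `2 * t`, then concavity forces linear decay. -/
lemma le_of_drop (hφ : IsGenerator φ) {a : ℝ} (ha : φ 0 = a) {t : ℝ≥0} (ht : 0 < t)
    (hdrop : φ (2 * t) < (a - 1 : ℝ)) (r : ℝ≥0) : φ r ≤ ((a + 1 - r / (2 * t) : ℝ) : EReal) := by
  rcases le_or_gt r (2 * t) with hr | hr
  · refine (hφ.antitone (zero_le (a := r))).trans ?_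
    rw [ha, EReal.coe_le_coe_iff]
    have : (r : ℝ) / (2 * t) ≤ 1 := by
      rw [div_le_one (by positivity)]; exact_mod_cast hr
    linarith
  · by_contra! hcon
    have h2t : 0 < 2 * t := by positivity
    have hr0 : 0 < r := h2t.trans hr
    have h := hφ.le_apply_mul ha hcon.le (div_pos h2t hr0) ((div_lt_one hr0).2 hr)
    rw [div_mul_cancel₀ _ hr0.ne'] at h
    have h' := EReal.coe_lt_coe_iff.1 (h.trans_lt hdrop)
    push_cast at h'
    have hr0' : (0 : ℝ) < r := hr0
    have ht' : (0 : ℝ) < t := ht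
    have : (1 - 2 * (t : ℝ) / r) * a + 2 * t / r * (a + 1 - r / (2 * t))
        = a - 1 + 2 * t / r := by field_simp; ring
    rw [this] at h'
    have : 0 < 2 * (t : ℝ) / r := by positivity
    linarith

end IsGenerator

variable {p : ℕ} {K : Set (EuclideanSpace ℝ (Fin p))}

lemma volume_gauge_lt_eq (K : Set (EuclideanSpace ℝ (Fin p))) {r : ℝ} (hr : 0 < r) :
    volume {x | gauge K x < r} = ENNReal.ofReal (r ^ p) * volume {x | gauge K x < 1} := by
  simpa using volume_cone_inter_lt (fun a ha x => IsBodyAroundZero.gauge_smul (K := K) ha x)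
    Set.univ hr

lemma le_withDensity_gauge_lt (hK : IsBodyAroundZero K) (hφ : IsGenerator φ) {t : ℝ≥0}
    (ht : 0 < t) {b : ℝ} (hb : (b : EReal) ≤ φ t) :
    ENNReal.ofReal (Real.exp b * t ^ p) * volume {x | gauge K x < 1} ≤
      (volume.withDensity fun x => profile φ (gauge K x)) {x | gauge K x < t} := by
  have hm : MeasurableSet {x | gauge K x < t} :=
    measurableSet_lt hK.continuous_gauge.measurable measurable_const
  rw [withDensity_apply _ hm, ENNReal.ofReal_mul (Real.exp_pos b).le, mul_assoc,
    ← volume_gauge_lt_eq K (r := t) ht, ← setLIntegral_const]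
  refine setLIntegral_mono' hm fun x hx => ?_
  rw [← EReal.exp_coe, profile]
  refine EReal.exp_monotone (hb.trans (hφ.antitone ?_))
  exact Real.toNNReal_le_iff_le_coe.2 (le_of_lt hx)

lemma withDensity_gauge_lt_le (hK : IsBodyAroundZero K) (hφ : IsGenerator φ) {a : ℝ}
    (ha : φ 0 = a) {r : ℝ} (hr : 0 < r) :
    (volume.withDensity fun x => profile φ (gauge K x)) {x | gauge K x < r} ≤
      ENNReal.ofReal (Real.exp a * r ^ p) * volume {x | gauge K x < 1} := by
  have hm : MeasurableSet {x | gauge K x < r} :=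
    measurableSet_lt hK.continuous_gauge.measurable measurable_const
  rw [withDensity_apply _ hm, ENNReal.ofReal_mul (Real.exp_pos a).le, mul_assoc,
    ← volume_gauge_lt_eq K hr, ← setLIntegral_const]
  refine setLIntegral_mono' hm fun x _ => ?_
  rw [← EReal.exp_coe, ← ha, profile]
  exact EReal.exp_monotone (hφ.antitone zero_le)

/-- A radial scale of the density: a point `t` where the generator has dropped by at most `1`,
while it has dropped by more than `1` at `2 * t`. It exists because the density is positive near
the origin and integrable. -/
lemma exists_radial_scale (hp : 1 ≤ p) (hK : IsBodyAroundZero K) (hφ : IsGenerator φ)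
    [hP : IsProbabilityMeasure (volume.withDensity fun x => profile φ (gauge K x))] :
    ∃ (a : ℝ) (t : ℝ≥0), φ 0 = a ∧ 0 < t ∧ ((a - 1 : ℝ) : EReal) ≤ φ t ∧
      φ (2 * t) < (a - 1 : ℝ) := by
  have hne : ∃ r, 0 < r ∧ φ r ≠ ⊥ := by
    by_contra! hcon
    have : (volume.withDensity fun x => profile φ (gauge K x)) Set.univ = 0 := by
      rw [withDensity_apply _ MeasurableSet.univ, Measure.restrict_univ]
      have h0 : ∀ᵐ x : EuclideanSpace ℝ (Fin p), x ≠ 0 := by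
        have : Nonempty (Fin p) := ⟨⟨0, hp⟩⟩
        simp [ae_iff]
      rw [lintegral_congr_ae (g := 0), lintegral_zero_fun]
      filter_upwards [h0] with x hx
      rw [profile, hcon _ (Real.toNNReal_pos.2 (hK.gauge_pos hx))]
      simp
    rw [measure_univ] at this
    exact one_ne_zero this
  obtain ⟨r, hr, hφr⟩ := hne
  have hφ0 : φ 0 ≠ ⊥ := fun h => hφr (le_bot_iff.1 (h ▸ hφ.antitone zero_le))
  obtain ⟨a, ha⟩ : ∃ a : ℝ, φ 0 = a := ⟨(φ 0).toReal, (EReal.coe_toReal (hφ.ne_top 0) hφ0).symm⟩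
  obtain ⟨b, hb⟩ : ∃ b : ℝ, φ r = b := ⟨(φ r).toReal, (EReal.coe_toReal (hφ.ne_top r) hφr).symm⟩
  have hba : b ≤ a := by
    have := hφ.antitone (zero_le (a := r))
    rwa [ha, hb, EReal.coe_le_coe_iff] at this
  -- the generator is close to its maximum near `0`
  have hS : ∃ t : ℝ≥0, 0 < t ∧ ((a - 1 : ℝ) : EReal) ≤ φ t := by
    set l : ℝ≥0 := ⟨1 / (a - b + 2), by have := sub_nonneg.2 hba; positivity⟩ with hl
    have hlv : (l : ℝ) = 1 / (a - b + 2) := rfl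
    have h2 : 0 < a - b + 2 := by linarith
    have hl0 : 0 < l := by
      rw [← NNReal.coe_pos, hlv]; positivity
    have hl1 : l < 1 := by
      rw [← NNReal.coe_lt_coe, hlv, NNReal.coe_one, div_lt_one h2]; linarith
    refine ⟨l * r, mul_pos hl0 hr, le_trans ?_ (hφ.le_apply_mul ha hb.ge hl0 hl1)⟩
    rw [EReal.coe_le_coe_iff, hlv]
    have : (1 - 1 / (a - b + 2)) * a + 1 / (a - b + 2) * b = a - (a - b) / (a - b + 2) := by
      field_simp; ring
    rw [this]
    have : (a - b) / (a - b + 2) ≤ 1 := by rw [div_le_one h2]; linarith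
    linarith
  obtain ⟨t, ht, hφt⟩ := hS
  by_contra! hcon
  have hall : ∀ j : ℕ, ((a - 1 : ℝ) : EReal) ≤ φ (2 ^ j * t) := by
    intro j
    induction j with
    | zero => simpa using hφt
    | succ j ih =>
      have := hcon a (2 ^ j * t) ha (by positivity) ih
      rwa [pow_succ', mul_assoc]
  -- otherwise the density exceeds a positive constant on arbitrarily large balls
  have hlow : ∀ j : ℕ,
      Real.exp (a - 1) * (2 ^ j * t) ^ p * volume.real {x | gauge K x < 1} ≤ 1 := by
    intro j
    have h := (le_withDensity_gauge_lt hK hφ (t := 2 ^ j * t) (by positivity) (hall j)).trans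
      prob_le_one
    have h' := ENNReal.toReal_mono ENNReal.one_ne_top h
    rw [ENNReal.toReal_mul, ENNReal.toReal_ofReal (by positivity), ENNReal.toReal_one] at h'
    simpa [Measure.real] using h'
  have hκ : 0 < volume.real {x | gauge K x < 1} :=
    ENNReal.toReal_pos hK.volume_gauge_lt_pos.ne' hK.volume_gauge_lt_ne_top
  set c := Real.exp (a - 1) * t ^ p * volume.real {x | gauge K x < 1} with hc
  have hc0 : 0 < c := by positivity
  obtain ⟨j, hj⟩ := pow_unbounded_of_one_lt (1 / c) (one_lt_two (α := ℝ))
  have h1 := hlow j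
  rw [div_lt_iff₀ hc0] at hj
  have h2 : (2 : ℝ) ^ j ≤ ((2 : ℝ) ^ j) ^ p := le_self_pow₀ (one_le_pow₀ one_le_two) (by omega)
  have h3 : Real.exp (a - 1) * (2 ^ j * t) ^ p * volume.real {x | gauge K x < 1}
      = (2 ^ j) ^ p * c := by rw [mul_pow, hc]; ring
  rw [h3] at h1
  nlinarith

lemma integrable_exp_neg_norm (p : ℕ) :
    Integrable (fun x : EuclideanSpace ℝ (Fin p) => Real.exp (-‖x‖)) := by
  have h := (integrable_one_add_norm (E := EuclideanSpace ℝ (Fin p)) (μ := volume)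
    (r := ((p + 1 : ℕ) : ℝ)) (by simp)).const_mul ((p + 1).factorial * Real.exp 1)
  refine h.mono' (by fun_prop) (Filter.Eventually.of_forall fun x => ?_)
  have hx : 0 < 1 + ‖x‖ := by positivity
  rw [Real.norm_of_nonneg (Real.exp_pos _).le, Real.rpow_neg hx.le, Real.rpow_natCast,
    ← div_eq_mul_inv, le_div_iff₀ (by positivity)]
  have h1 := Real.pow_div_factorial_le_exp (1 + ‖x‖) hx.le (p + 1)
  rw [div_le_iff₀ (by positivity)] at h1
  calc Real.exp (-‖x‖) * (1 + ‖x‖) ^ (p + 1)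
      ≤ Real.exp (-‖x‖) * (Real.exp (1 + ‖x‖) * (p + 1).factorial) := by gcongr
    _ = _ := by rw [← mul_assoc, ← Real.exp_add]; ring_nf

/-- The constant in the exponential tail bound for the gauge of an observation. -/
noncomputable def tailConst (p : ℕ) (r₀ : ℝ) : ℝ :=
  Real.exp 2 * (4 * r₀) ^ p * (∫ x : EuclideanSpace ℝ (Fin p), Real.exp (-‖x‖)) /
    volume.real (Metric.ball (0 : EuclideanSpace ℝ (Fin p)) 1)

/-- At a suitable scale `t` the gauge of an observation is at least `t / 4` with probability at
least `1 / 2`, and has an exponential tail. -/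
lemma exists_scale_radial_bounds (hp : 2 ≤ p) (hK : IsBodyAroundZero K) (hφ : IsGenerator φ)
    [hP : IsProbabilityMeasure (volume.withDensity fun x => profile φ (gauge K x))]
    {r₁ r₂ : ℝ} (h₁ : 0 < r₁) (h₂ : r₁ ≤ r₂)
    (hb₁ : Metric.closedBall 0 r₁ ⊆ K) (hb₂ : K ⊆ Metric.closedBall 0 r₂) :
    ∃ t : ℝ, 0 < t ∧
      (volume.withDensity fun x => profile φ (gauge K x)).real {x | gauge K x < t / 4} ≤ 1 / 2 ∧
      ∀ s : ℝ, (volume.withDensity fun x => profile φ (gauge K x)).real {x | s < gauge K x} ≤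
        tailConst p (r₂ / r₁) * Real.exp (-(s / (4 * t))) := by
  obtain ⟨a, t, ha, ht, hlow, hdrop⟩ := exists_radial_scale (by omega) hK hφ
  have hr₂ : 0 < r₂ := h₁.trans_le h₂
  have ht' : (0 : ℝ) < t := ht
  set κ := volume.real {x | gauge K x < 1} with hκ
  have hκ0 : 0 < κ := ENNReal.toReal_pos hK.volume_gauge_lt_pos.ne' hK.volume_gauge_lt_ne_top
  have hnorm : Real.exp (a - 1) * t ^ p * κ ≤ 1 := by
    have h := (le_withDensity_gauge_lt hK hφ ht hlow).trans prob_le_one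
    have h' := ENNReal.toReal_mono ENNReal.one_ne_top h
    rw [ENNReal.toReal_mul, ENNReal.toReal_ofReal (by positivity), ENNReal.toReal_one] at h'
    exact h'
  have hexp : Real.exp a * t ^ p * κ ≤ Real.exp 1 := by
    have e : Real.exp a = Real.exp 1 * Real.exp (a - 1) := by rw [← Real.exp_add]; ring_nf
    rw [e]
    have := mul_le_mul_of_nonneg_left hnorm (Real.exp_pos 1).le
    linarith
  refine ⟨t, ht', ?_, fun s => ?_⟩
  · have h := withDensity_gauge_lt_le hK hφ ha (r := t / 4) (by positivity)
    have h' := ENNReal.toReal_mono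
      (ENNReal.mul_ne_top ENNReal.ofReal_ne_top hK.volume_gauge_lt_ne_top) h
    rw [ENNReal.toReal_mul, ENNReal.toReal_ofReal (by positivity)] at h'
    refine h'.trans ?_
    change Real.exp a * (t / 4) ^ p * κ ≤ 1 / 2
    have h4 : (16 : ℝ) ≤ 4 ^ p := by
      calc (16 : ℝ) = 4 ^ 2 := by norm_num
        _ ≤ 4 ^ p := pow_le_pow_right₀ (by norm_num) hp
    rw [div_pow, mul_div_assoc', div_mul_eq_mul_div, div_le_iff₀ (by positivity)]
    have := Real.exp_one_lt_d9
    linarith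
  · have hm : MeasurableSet {x | s < gauge K x} :=
      measurableSet_lt measurable_const hK.continuous_gauge.measurable
    set R := 4 * t * r₂ with hR
    have hR0 : 0 < R := by positivity
    have hint : Integrable fun x : EuclideanSpace ℝ (Fin p) => Real.exp (-‖R⁻¹ • x‖) :=
      (integrable_exp_neg_norm p).comp_smul (inv_ne_zero hR0.ne')
    have hpt : ∀ x ∈ {x | s < gauge K x}, profile φ (gauge K x) ≤
        ENNReal.ofReal (Real.exp (a + 1 - s / (4 * t)) * Real.exp (-‖R⁻¹ • x‖)) := by
      intro x hx
      have hx : s < gauge K x := hx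
      rw [← Real.exp_add, ← EReal.exp_coe, profile]
      refine EReal.exp_monotone ((hφ.le_of_drop ha ht hdrop _).trans ?_)
      rw [EReal.coe_le_coe_iff, Real.coe_toNNReal _ (gauge_nonneg x), norm_smul, norm_inv,
        Real.norm_of_nonneg hR0.le]
      have e1 : s / (4 * t) ≤ gauge K x / (4 * t) := by gcongr
      have e2 : R⁻¹ * ‖x‖ ≤ gauge K x / (4 * t) := by
        have := hK.norm_div_le_gauge hr₂ hb₂ x
        calc R⁻¹ * ‖x‖ = (‖x‖ / r₂) / (4 * t) := by rw [hR]; field_simp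
          _ ≤ _ := by gcongr
      have e3 : gauge K x / (2 * t) = gauge K x / (4 * t) + gauge K x / (4 * t) := by
        field_simp; ring
      linarith
    have h : (volume.withDensity fun x => profile φ (gauge K x)) {x | s < gauge K x} ≤
        ENNReal.ofReal (∫ x : EuclideanSpace ℝ (Fin p),
          Real.exp (a + 1 - s / (4 * t)) * Real.exp (-‖R⁻¹ • x‖)) := by
      rw [withDensity_apply _ hm, ofReal_integral_eq_lintegral_ofReal (hint.const_mul _)
        (Filter.Eventually.of_forall fun x => by positivity)]
      exact (setLIntegral_mono' hm hpt).trans (setLIntegral_le_lintegral _ _)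
    have h' := ENNReal.toReal_mono ENNReal.ofReal_ne_top h
    rw [ENNReal.toReal_ofReal (integral_nonneg fun x => by positivity), integral_const_mul,
      Measure.integral_comp_inv_smul_of_nonneg volume
        (fun x : EuclideanSpace ℝ (Fin p) => Real.exp (-‖x‖)) hR0.le,
      finrank_euclideanSpace_fin, smul_eq_mul] at h'
    refine h'.trans ?_
    set I := ∫ x : EuclideanSpace ℝ (Fin p), Real.exp (-‖x‖) with hI
    have hI0 : 0 ≤ I := integral_nonneg fun x => by positivity
    have hω := volume_real_unitBall_pos (p := p)
    have hκω := le_volume_real_gauge_lt hK h₁ hb₁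
    set ω := volume.real (Metric.ball (0 : EuclideanSpace ℝ (Fin p)) 1) with hωd
    have hmain : Real.exp a * t ^ p * (r₁ ^ p * ω) ≤ Real.exp 1 :=
      le_trans (by gcongr) hexp
    have e1 : Real.exp (a + 1 - s / (4 * t))
        = Real.exp a * Real.exp 1 * Real.exp (-(s / (4 * t))) := by
      rw [← Real.exp_add, ← Real.exp_add]; ring_nf
    have e2 : Real.exp 2 = Real.exp 1 * Real.exp 1 := by rw [← Real.exp_add]; norm_num
    have e3 : Real.exp a * t ^ p ≤ Real.exp 1 / (r₁ ^ p * ω) := by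
      rwa [le_div_iff₀ (by positivity)]
    calc Real.exp (a + 1 - s / (4 * t)) * (R ^ p * I)
        = (Real.exp a * t ^ p) * (Real.exp 1 * (4 * r₂) ^ p * I * Real.exp (-(s / (4 * t)))) := by
          rw [e1, hR, show 4 * (t : ℝ) * r₂ = t * (4 * r₂) by ring, mul_pow]; ring
      _ ≤ Real.exp 1 / (r₁ ^ p * ω) *
          (Real.exp 1 * (4 * r₂) ^ p * I * Real.exp (-(s / (4 * t)))) := by gcongr
      _ = tailConst p (r₂ / r₁) * Real.exp (-(s / (4 * t))) := by
          rw [tailConst, e2, ← hI, ← hωd, mul_div_assoc', div_pow]; field_simp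

end Radial

/-! ### Counting independent observations in caps -/

section Counting

variable {ι Ω : Type*} [Fintype ι]

section Chernoff

variable {E : Type*}

/-- The number of observations falling in `A`. -/
noncomputable def countIn (Y : ι → Ω → E) (A : Set E)
    (ω : Ω) : ℝ := ∑ j, A.indicator (fun _ => (1 : ℝ)) (Y j ω)

lemma countIn_eq_card (Y : ι → Ω → E) (A : Set E) (ω : Ω) [DecidablePred fun j => Y j ω ∈ A] :
    countIn Y A ω = ((Finset.univ.filter fun j => Y j ω ∈ A).card : ℝ) := by
  classical
  simp [countIn, Set.indicator_apply]

lemma countIn_mem_Icc (Y : ι → Ω → E) (A : Set E) (ω : Ω) :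
    countIn Y A ω ∈ Set.Icc (0 : ℝ) (Fintype.card ι) := by
  refine ⟨Finset.sum_nonneg fun j _ => Set.indicator_nonneg (fun _ _ => zero_le_one) _, ?_⟩
  have h : ∀ j ∈ Finset.univ, A.indicator (fun _ => (1 : ℝ)) (Y j ω) ≤ 1 := fun j _ =>
    Set.indicator_le_self' (fun _ _ => zero_le_one) _
  simpa [countIn] using Finset.sum_le_sum h

variable [MeasurableSpace Ω] {P : Measure Ω} [MeasurableSpace E] {Y : ι → Ω → E} {μ : Measure E}
  {A : Set E}

lemma measurable_countIn (hY : ∀ j, Measurable (Y j)) (hA : MeasurableSet A) :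
    Measurable (countIn Y A) :=
  Finset.measurable_sum _ fun j _ => (measurable_const.indicator hA).comp (hY j)

variable [IsProbabilityMeasure P]

lemma integrable_exp_mul_countIn (hY : ∀ j, Measurable (Y j)) (hA : MeasurableSet A) (l : ℝ) :
    Integrable (fun ω => Real.exp (l * countIn Y A ω)) P :=
  integrable_exp_mul_of_mem_Icc (measurable_countIn hY hA).aemeasurable
    (Filter.Eventually.of_forall fun ω => countIn_mem_Icc Y A ω)

/-- The moment generating function of a binomial count is at most that of a Poisson variable
with the same mean. -/
lemma mgf_countIn_le (hY : ∀ j, Measurable (Y j)) (hind : iIndepFun Y P)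
    (hlaw : ∀ j, P.map (Y j) = μ) (hA : MeasurableSet A) (l : ℝ) :
    mgf (countIn Y A) P l ≤
      Real.exp (Fintype.card ι * μ.real A * (Real.exp l - 1)) := by
  have hm : Measurable (A.indicator fun _ => (1 : ℝ)) := measurable_const.indicator hA
  have hind' : iIndepFun (fun j ω => A.indicator (fun _ => (1 : ℝ)) (Y j ω)) P :=
    hind.comp (fun _ => A.indicator fun _ => (1 : ℝ)) fun _ => hm
  have hsum : countIn Y A = ∑ j, fun ω => A.indicator (fun _ => (1 : ℝ)) (Y j ω) := by
    ext ω; simp [countIn]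
  rw [hsum, hind'.mgf_sum (fun j => hm.comp (hY j))]
  have hone : ∀ j, mgf (fun ω => A.indicator (fun _ => (1 : ℝ)) (Y j ω)) P l ≤
      Real.exp (μ.real A * (Real.exp l - 1)) := by
    intro j
    have hpre : μ.real A = P.real (Y j ⁻¹' A) := by
      rw [← hlaw j, map_measureReal_apply (hY j) hA]
    have hfun : (fun ω => Real.exp (l * A.indicator (fun _ => (1 : ℝ)) (Y j ω))) =
        fun ω => 1 + (Y j ⁻¹' A).indicator (fun _ => Real.exp l - 1) ω := by
      ext ω
      by_cases h : Y j ω ∈ A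
      · simp [h]
      · simp [h]
    rw [mgf, hfun, integral_add (integrable_const _)
      ((integrable_const _).indicator ((hY j) hA)), integral_indicator_const _ ((hY j) hA), hpre]
    simp only [integral_const, probReal_univ, smul_eq_mul, one_mul]
    linarith [Real.add_one_le_exp (P.real (Y j ⁻¹' A) * (Real.exp l - 1))]
  calc _ ≤ ∏ _j : ι, Real.exp (μ.real A * (Real.exp l - 1)) :=
        Finset.prod_le_prod (fun j _ => mgf_nonneg) fun j _ => hone j
    _ = _ := by
        rw [Finset.prod_const, Finset.card_univ, ← Real.exp_nat_mul]
        ring_nf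

lemma prob_countIn_le_le (hY : ∀ j, Measurable (Y j)) (hind : iIndepFun Y P)
    (hlaw : ∀ j, P.map (Y j) = μ) (hA : MeasurableSet A) {c : ℝ} (hc : c ≤ μ.real A) (a : ℝ) :
    P.real {ω | countIn Y A ω ≤ a} ≤ Real.exp (a - Fintype.card ι * c / 2) := by
  refine (measure_le_le_exp_mul_mgf a (t := -1) (by norm_num)
    (integrable_exp_mul_countIn hY hA _)).trans ?_
  refine (mul_le_mul_of_nonneg_left (mgf_countIn_le hY hind hlaw hA _) (Real.exp_pos _).le).trans ?_
  rw [← Real.exp_add, Real.exp_le_exp]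
  have h1 : Real.exp (-1) ≤ 1 / 2 := by
    rw [Real.exp_neg, one_div]
    exact inv_anti₀ (by norm_num) (by linarith [Real.add_one_le_exp (1 : ℝ)])
  have h2 : (0 : ℝ) ≤ Fintype.card ι := by positivity
  have h3 : (Fintype.card ι : ℝ) * c ≤ Fintype.card ι * μ.real A := by gcongr
  have h4 : 0 ≤ (Fintype.card ι : ℝ) * μ.real A := mul_nonneg h2 measureReal_nonneg
  nlinarith

lemma prob_le_countIn_le (hY : ∀ j, Measurable (Y j)) (hind : iIndepFun Y P)
    (hlaw : ∀ j, P.map (Y j) = μ) (hA : MeasurableSet A) {c : ℝ} (hc : μ.real A ≤ c) (a : ℝ)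
    {l : ℝ} (hl : 0 ≤ l) :
    P.real {ω | a ≤ countIn Y A ω} ≤
      Real.exp (Fintype.card ι * c * (Real.exp l - 1) - l * a) := by
  refine (measure_ge_le_exp_mul_mgf a hl (integrable_exp_mul_countIn hY hA _)).trans ?_
  refine (mul_le_mul_of_nonneg_left (mgf_countIn_le hY hind hlaw hA _) (Real.exp_pos _).le).trans ?_
  rw [← Real.exp_add, Real.exp_le_exp]
  have h1 : 0 ≤ Real.exp l - 1 := sub_nonneg.2 (Real.one_le_exp hl)
  have h3 : Fintype.card ι * μ.real A * (Real.exp l - 1) ≤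
    Fintype.card ι * c * (Real.exp l - 1) := by gcongr
  linarith

end Chernoff

variable {p : ℕ} [MeasurableSpace Ω] {P : Measure Ω} [IsProbabilityMeasure P]
  {Y : ι → Ω → EuclideanSpace ℝ (Fin p)} 
  {μ : Measure (EuclideanSpace ℝ (Fin p))}

/-- With high probability every cap of radius `r` contains many of the observed directions:
a cap centred at a point of an `r / 2`-net with half the radius is contained in it. -/
lemma prob_exists_cap_few_le (hY : ∀ j, Measurable (Y j)) (hind : iIndepFun Y P)
    (hlaw : ∀ j, P.map (Y j) = μ) {r c : ℝ} (hr : 0 < r) (hr1 : r ≤ 1)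
    (hcap : ∀ u, ‖u‖ = 1 → c ≤ μ.real (capCone u (r / 2))) (a : ℕ) :
    P.real {ω | ∃ u, ‖u‖ = 1 ∧
        (Finset.univ.filter fun j => ‖unitDir (Y j ω) - u‖ ≤ r).card < a} ≤
      (8 / r) ^ p * Real.exp (a - Fintype.card ι * c / 2) := by
  classical
  obtain ⟨T, hT1, hTcard, hTnet⟩ := exists_sphere_net p (r := r / 2) (by positivity) (by linarith)
  have hsub : {ω | ∃ u, ‖u‖ = 1 ∧
        (Finset.univ.filter fun j => ‖unitDir (Y j ω) - u‖ ≤ r).card < a} ⊆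
      ⋃ v ∈ T, {ω | countIn Y (capCone v (r / 2)) ω ≤ a} := by
    rintro ω ⟨u, hu, hcard⟩
    obtain ⟨v, hv, huv⟩ := hTnet u hu
    refine Set.mem_iUnion₂.2 ⟨v, hv, ?_⟩
    change countIn Y (capCone v (r / 2)) ω ≤ a
    rw [countIn_eq_card, Nat.cast_le]
    refine (Finset.card_le_card fun j hj => ?_).trans hcard.le
    have hj : ‖unitDir (Y j ω) - v‖ ≤ r / 2 := (Finset.mem_filter.1 hj).2
    refine Finset.mem_filter.2 ⟨Finset.mem_univ j, ?_⟩
    have : unitDir (Y j ω) - u = (unitDir (Y j ω) - v) - (u - v) := by abel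
    rw [this]
    linarith [norm_sub_le (unitDir (Y j ω) - v) (u - v)]
  refine (measureReal_mono hsub (measure_ne_top _ _)).trans
    ((measureReal_biUnion_finset_le _ _).trans ?_)
  refine (Finset.sum_le_sum fun v hv => prob_countIn_le_le hY hind hlaw
    (measurableSet_capCone v _) (hcap v (hT1 v hv)) a).trans ?_
  rw [Finset.sum_const, nsmul_eq_mul]
  refine mul_le_mul_of_nonneg_right (hTcard.trans (le_of_eq ?_)) (Real.exp_pos _).le
  congr 1; field_simp; norm_num

/-- With high probability no cap of radius `r` contains many of the observed directions. -/
lemma prob_exists_cap_many_le (hY : ∀ j, Measurable (Y j)) (hind : iIndepFun Y P)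
    (hlaw : ∀ j, P.map (Y j) = μ) {r c : ℝ} (hr : 0 < r) (hr1 : r ≤ 1)
    (hcap : ∀ u, ‖u‖ = 1 → μ.real (capCone u (2 * r)) ≤ c) (a : ℕ) {l : ℝ} (hl : 0 ≤ l) :
    P.real {ω | ∃ u, ‖u‖ = 1 ∧
        a < (Finset.univ.filter fun j => ‖unitDir (Y j ω) - u‖ ≤ r).card} ≤
      (4 / r) ^ p * Real.exp (Fintype.card ι * c * (Real.exp l - 1) - l * a) := by
  classical
  obtain ⟨T, hT1, hTcard, hTnet⟩ := exists_sphere_net p hr hr1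
  have hsub : {ω | ∃ u, ‖u‖ = 1 ∧
        a < (Finset.univ.filter fun j => ‖unitDir (Y j ω) - u‖ ≤ r).card} ⊆
      ⋃ v ∈ T, {ω | a ≤ countIn Y (capCone v (2 * r)) ω} := by
    rintro ω ⟨u, hu, hcard⟩
    obtain ⟨v, hv, huv⟩ := hTnet u hu
    refine Set.mem_iUnion₂.2 ⟨v, hv, ?_⟩
    change (a : ℝ) ≤ countIn Y (capCone v (2 * r)) ω
    rw [countIn_eq_card, Nat.cast_le]
    refine hcard.le.trans (Finset.card_le_card fun j hj => ?_)
    have hj : ‖unitDir (Y j ω) - u‖ ≤ r := (Finset.mem_filter.1 hj).2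
    refine Finset.mem_filter.2 ⟨Finset.mem_univ j, ?_⟩
    change ‖unitDir (Y j ω) - v‖ ≤ 2 * r
    have : unitDir (Y j ω) - v = (unitDir (Y j ω) - u) + (u - v) := by abel
    rw [this]
    linarith [norm_add_le (unitDir (Y j ω) - u) (u - v)]
  refine (measureReal_mono hsub (measure_ne_top _ _)).trans
    ((measureReal_biUnion_finset_le _ _).trans ?_)
  refine (Finset.sum_le_sum fun v hv => prob_le_countIn_le hY hind hlaw
    (measurableSet_capCone v _) (hcap v (hT1 v hv)) a hl).trans ?_
  rw [Finset.sum_const, nsmul_eq_mul]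
  exact mul_le_mul_of_nonneg_right hTcard (Real.exp_pos _).le

end Counting

/-! ### Averages over a selection made by independent directions -/

section Averages

variable {Ω : Type*} [MeasurableSpace Ω] {P : Measure Ω} [IsProbabilityMeasure P]

lemma map_pi_comp {ι E γ : Type*} [Fintype ι] [MeasurableSpace E] [MeasurableSpace γ]
    {X : ι → Ω → E} {μ : Measure E} (hX : ∀ i, Measurable (X i)) (hind : iIndepFun X P)
    (hlaw : ∀ i, P.map (X i) = μ) {f : E → γ} (hf : Measurable f) :
    P.map (fun ω i => f (X i ω)) = Measure.pi fun _ : ι => μ.map f := by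
  have h := (iIndepFun_iff_map_fun_eq_pi_map
    (fun i => (hf.comp (hX i)).aemeasurable)).1 (hind.comp (fun _ => f) fun _ => hf)
  refine h.trans ?_
  congr 1
  ext1 i
  rw [← hlaw i, Measure.map_map hf (hX i)]

/-- If the two components of each observation are independent, then so are the two vectors of
components of an independent sample. -/
lemma indepFun_pi_of_indepFun {ι E α β : Type*} [Fintype ι] [MeasurableSpace E]
    [MeasurableSpace α] [MeasurableSpace β] {X : ι → Ω → E} {μ : Measure E}
    (hX : ∀ i, Measurable (X i)) (hind : iIndepFun X P) (hlaw : ∀ i, P.map (X i) = μ)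
    [IsProbabilityMeasure μ] {g : E → α} {d : E → β} (hg : Measurable g) (hd : Measurable d)
    (hgd : IndepFun g d μ) :
    IndepFun (fun ω i => g (X i ω)) (fun ω i => d (X i ω)) P := by
  have : IsProbabilityMeasure (μ.map g) := Measure.isProbabilityMeasure_map hg.aemeasurable
  have : IsProbabilityMeasure (μ.map d) := Measure.isProbabilityMeasure_map hd.aemeasurable
  have hgd' : Measurable fun x => (g x, d x) := hg.prodMk hd
  have hpair := (indepFun_iff_map_prod_eq_prod_map_map hg.aemeasurable hd.aemeasurable).1 hgd
  have hmg : Measurable fun ω i => g (X i ω) := measurable_pi_lambda _ fun i => hg.comp (hX i)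
  have hmd : Measurable fun ω i => d (X i ω) := measurable_pi_lambda _ fun i => hd.comp (hX i)
  have hmgd : Measurable fun ω i => (g (X i ω), d (X i ω)) :=
    measurable_pi_lambda _ fun i => hgd'.comp (hX i)
  rw [indepFun_iff_map_prod_eq_prod_map_map hmg.aemeasurable hmd.aemeasurable]
  rw [map_pi_comp hX hind hlaw hg, map_pi_comp hX hind hlaw hd,
    ← (measurePreserving_arrowProdEquivProdArrow α β ι (fun _ => μ.map g)
      (fun _ => μ.map d)).map_eq, ← hpair, ← map_pi_comp hX hind hlaw hgd',
    Measure.map_map (MeasurableEquiv.measurable _) hmgd]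
  rfl

/-- A random index set that is independent of the data may be treated as fixed. -/
lemma prob_selection_le {ι α β : Type*} [Finite ι] [MeasurableSpace α] [MeasurableSpace β]
    {V : Ω → α} {W : Ω → β} (hVW : IndepFun V W P) {s : α → ι} (hs : ∀ i, MeasurableSet (s ⁻¹' {i}))
    {bad : ι → Set β} (hbad : ∀ i, MeasurableSet (bad i)) (hV : Measurable V) {η : ℝ} (hη : 0 ≤ η)
    (h : ∀ i, P.real (W ⁻¹' bad i) ≤ η) :
    P.real {ω | W ω ∈ bad (s (V ω))} ≤ η := by
  classical
  have := Fintype.ofFinite ι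
  have hsub : {ω | W ω ∈ bad (s (V ω))} ⊆
      ⋃ i ∈ (Finset.univ : Finset ι), (V ⁻¹' (s ⁻¹' {i}) ∩ W ⁻¹' bad i) := fun ω hω =>
    Set.mem_iUnion₂.2 ⟨s (V ω), Finset.mem_univ _, rfl, hω⟩
  have hdisj : ((Finset.univ : Finset ι) : Set ι).PairwiseDisjoint
      fun i => V ⁻¹' (s ⁻¹' {i}) := by
    intro i _ j _ hij
    refine Set.disjoint_left.2 fun ω hi hj => hij ?_
    exact (show s (V ω) = i from hi).symm.trans hj
  refine (measureReal_mono hsub (measure_ne_top _ _)).trans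
    ((measureReal_biUnion_finset_le _ _).trans ?_)
  have hprod : ∀ i, P.real (V ⁻¹' (s ⁻¹' {i}) ∩ W ⁻¹' bad i) ≤ P.real (V ⁻¹' (s ⁻¹' {i})) * η := by
    intro i
    rw [Measure.real, hVW.measure_inter_preimage_eq_mul _ _ (hs i) (hbad i), ENNReal.toReal_mul]
    exact mul_le_mul_of_nonneg_left (h i) ENNReal.toReal_nonneg
  refine (Finset.sum_le_sum fun i _ => hprod i).trans ?_
  rw [← Finset.sum_mul, ← measureReal_biUnion_finset hdisj fun i _ => hV (hs i)]
  exact mul_le_of_le_one_left hη measureReal_le_one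

/-- Hoeffding's inequality, two-sided, for the average over an index set. -/
lemma prob_abs_sum_sub_le {ι : Type*} {Z : ι → Ω → ℝ} (hind : iIndepFun Z P)
    (hZ : ∀ i, Measurable (Z i)) {L c a : ℝ} (hL : 0 < L) (hZL : ∀ i ω, Z i ω ∈ Set.Icc 0 L)
    (hmean : ∀ i, ∫ ω, Z i ω ∂P = c) (ha : 0 ≤ a) {I : Finset ι} (hI : 0 < I.card) :
    P.real {ω | I.card * a ≤ |∑ i ∈ I, Z i ω - I.card * c|} ≤
      2 * Real.exp (-(2 * I.card * a ^ 2 / L ^ 2)) := by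
  have hsg : ∀ i, HasSubgaussianMGF (fun ω => Z i ω - c) ((‖L - 0‖₊ / 2) ^ 2) P := by
    intro i
    have := hasSubgaussianMGF_of_mem_Icc (hZ i).aemeasurable
      (Filter.Eventually.of_forall (hZL i) : ∀ᵐ ω ∂P, _)
    rwa [hmean i] at this
  have hind1 : iIndepFun (fun i ω => Z i ω - c) P :=
    hind.comp (fun _ z => z - c) fun _ => measurable_id.sub_const c
  have hind2 : iIndepFun (fun i ω => -(Z i ω - c)) P :=
    hind1.comp (fun _ z => -z) fun _ => measurable_neg
  have hI' : (0 : ℝ) < I.card := by exact_mod_cast hI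
  have hpos : (0 : ℝ) ≤ I.card * a := by positivity
  have b1 := HasSubgaussianMGF.measure_sum_ge_le_of_iIndepFun hind1 (s := I)
    (fun i _ => hsg i) hpos
  have b2 := HasSubgaussianMGF.measure_sum_ge_le_of_iIndepFun hind2 (s := I)
    (fun i _ => (hsg i).neg) hpos
  have hexp : -((I.card : ℝ) * a) ^ 2 / (2 * ((∑ _i ∈ I, (‖L - 0‖₊ / 2) ^ 2 : ℝ≥0) : ℝ)) =
      -(2 * I.card * a ^ 2 / L ^ 2) := by
    rw [Finset.sum_const, nsmul_eq_mul]
    push_cast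
    rw [sub_zero, Real.norm_of_nonneg hL.le]
    field_simp
  rw [hexp] at b1 b2
  have hsub : {ω | I.card * a ≤ |∑ i ∈ I, Z i ω - I.card * c|} ⊆
      {ω | I.card * a ≤ ∑ i ∈ I, (Z i ω - c)} ∪ {ω | I.card * a ≤ ∑ i ∈ I, -(Z i ω - c)} := by
    intro ω hω
    have e : ∑ i ∈ I, (Z i ω - c) = ∑ i ∈ I, Z i ω - I.card * c := by
      rw [Finset.sum_sub_distrib, Finset.sum_const, nsmul_eq_mul]
    rcases le_abs.1 (show I.card * a ≤ |∑ i ∈ I, Z i ω - I.card * c| from hω) with h | h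
    · exact Or.inl (by rw [Set.mem_ofPred_eq, e]; exact h)
    · exact Or.inr (by rw [Set.mem_ofPred_eq, Finset.sum_neg_distrib, e]; exact h)
  refine (measureReal_mono hsub (measure_ne_top _ _)).trans ((measureReal_union_le _ _).trans ?_)
  linarith

end Averages

/-! ### The estimator on a typical sample -/

section Typical

variable {p n M : ℕ} {K : Set (EuclideanSpace ℝ (Fin p))} {r₁ r₂ : ℝ}

/-- If every selection is near its direction `θ m` and the gauges of the selected observations
average to nearly `c`, then `radius X m` is nearly `c` times the radius of `K` along `θ m`. -/
lemma radius_mul_gauge_bounds (hK : IsBodyAroundZero K) (h₁ : 0 < r₁) (h₂ : r₁ ≤ r₂)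
    (hb₁ : Metric.closedBall 0 r₁ ⊆ K) (hb₂ : K ⊆ Metric.closedBall 0 r₂)
    (X : Fin (n + M) → EuclideanSpace ℝ (Fin p)) (hX : ∀ j, X j ≠ 0) (m : Fin M) {δ ε c : ℝ}
    (hδ1 : r₂ / r₁ * δ ≤ 1) (hε : 0 ≤ ε) (hc : 0 < c)
    (hI : 0 < (coneIndices X m).card)
    (hnear : ∀ i ∈ coneIndices X m,
      ‖unitDir (X (Fin.natAdd n m)) - unitDir (X (Fin.castAdd M i))‖ ≤ δ)
    (havg : |∑ i ∈ coneIndices X m, gauge K (X (Fin.castAdd M i)) - (coneIndices X m).card * c| ≤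
      (coneIndices X m).card * (ε * c)) :
    1 - (r₂ / r₁ * δ + 2 * ε) ≤ c⁻¹ * radius X m * gauge K (direction X m) ∧
      c⁻¹ * radius X m * gauge K (direction X m) ≤ 1 + (r₂ / r₁ * δ + 2 * ε) := by
  have hr₂ : 0 < r₂ := h₁.trans_le h₂
  set I := coneIndices X m
  obtain ⟨i₀, hi₀⟩ := Finset.card_pos.1 hI
  have hδ : 0 ≤ δ := (norm_nonneg _).trans (hnear i₀ hi₀)
  set β := r₂ / r₁ * δ with hβ
  have hβ0 : 0 ≤ β := by positivity
  set G := gauge K (direction X m)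
  have hI' : (0 : ℝ) < I.card := by exact_mod_cast hI
  have hR : ∀ i, gauge K (X (Fin.castAdd M i))
      = ‖X (Fin.castAdd M i)‖ * gauge K (unitDir (X (Fin.castAdd M i))) := by
    intro i
    conv_lhs => rw [← norm_smul_unitDir (X (Fin.castAdd M i))]
    rw [IsBodyAroundZero.gauge_smul (norm_nonneg _)]
  have hup : ∀ i ∈ I, ‖X (Fin.castAdd M i)‖ * G ≤ (1 + β) * gauge K (X (Fin.castAdd M i)) := by
    intro i hi
    have h : G ≤ (1 + β) * gauge K (unitDir (X (Fin.castAdd M i))) :=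
      hK.gauge_le_mul_of_unit h₁ hr₂ hb₁ hb₂ (hnear i hi) (norm_unitDir (hX _))
    rw [hR i]
    have := mul_le_mul_of_nonneg_left h (norm_nonneg (X (Fin.castAdd M i)))
    linarith
  have hlo : ∀ i ∈ I, (1 - β) * gauge K (X (Fin.castAdd M i)) ≤ ‖X (Fin.castAdd M i)‖ * G := by
    intro i hi
    have h : gauge K (unitDir (X (Fin.castAdd M i))) ≤ (1 + β) * G :=
      hK.gauge_le_mul_of_unit h₁ hr₂ hb₁ hb₂ (by rw [norm_sub_rev]; exact hnear i hi)
        (norm_unitDir (hX _))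
    have hG : 0 ≤ G := gauge_nonneg _
    have h' : (1 - β) * gauge K (unitDir (X (Fin.castAdd M i))) ≤ G := by
      have := mul_le_mul_of_nonneg_left h (sub_nonneg.2 hδ1)
      have h3 : (1 - β) * ((1 + β) * G) ≤ G := by nlinarith [mul_nonneg (mul_nonneg hβ0 hβ0) hG]
      linarith
    rw [hR i]
    have := mul_le_mul_of_nonneg_left h' (norm_nonneg (X (Fin.castAdd M i)))
    linarith
  set S := ∑ i ∈ I, gauge K (X (Fin.castAdd M i)) with hS
  set T := ∑ i ∈ I, ‖X (Fin.castAdd M i)‖ with hT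
  have hup' : T * G ≤ (1 + β) * S := by
    rw [hT, hS, Finset.sum_mul, Finset.mul_sum]; exact Finset.sum_le_sum hup
  have hlo' : (1 - β) * S ≤ T * G := by
    rw [hT, hS, Finset.sum_mul, Finset.mul_sum]; exact Finset.sum_le_sum hlo
  obtain ⟨a1, a2⟩ := abs_le.1 havg
  have hval : c⁻¹ * radius X m * G = T * G / (I.card * c) := by
    rw [radius]; change c⁻¹ * ((I.card : ℝ)⁻¹ * T) * G = _
    field_simp
  have hden : 0 < I.card * c := by positivity
  rw [hval]
  constructor
  · rw [le_div_iff₀ hden]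
    have h1 : (1 - ε) * (I.card * c) ≤ S := by linarith
    have h2 := mul_le_mul_of_nonneg_left h1 (sub_nonneg.2 hδ1)
    have h3 : (1 - (β + 2 * ε)) * (I.card * c) ≤ (1 - β) * ((1 - ε) * (I.card * c)) := by
      have : 0 ≤ (ε + β * ε) * (I.card * c) := by positivity
      linarith
    linarith
  · rw [div_le_iff₀ hden]
    have h1 : S ≤ (1 + ε) * (I.card * c) := by linarith
    have h2 := mul_le_mul_of_nonneg_left h1 (by positivity : 0 ≤ 1 + β)
    have h3 : (1 + β) * ((1 + ε) * (I.card * c)) ≤ (1 + (β + 2 * ε)) * (I.card * c) := by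
      have : 0 ≤ (1 - β) * (ε * (I.card * c)) := mul_nonneg (sub_nonneg.2 hδ1) (by positivity)
      linarith
    linarith

/-- The error bound on a typical sample: caps of radius `δ` contain at least `k` directions, caps
of radius `2η` at most `k`, caps of radius `η` at least `N` observations, no gauge exceeds `L`, and
the truncated gauges average to nearly `c` over every selected index set. -/
lemma iInf_dScale_le_of_typical (hK : IsBodyAroundZero K) (h₁ : 0 < r₁) (h₂ : r₁ ≤ r₂)
    (hb₁ : Metric.closedBall 0 r₁ ⊆ K) (hb₂ : K ⊆ Metric.closedBall 0 r₂)
    (X : Fin (n + M) → EuclideanSpace ℝ (Fin p)) (hX : ∀ j, X j ≠ 0) {k N : ℕ}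
    (hkn : ⌊Real.log n⌋₊ = k) (hk : 1 ≤ k) (hkM : k ≤ M) (hN : 1 ≤ N) {δ η ε c L E : ℝ}
    (hδ0 : 0 ≤ δ) (hδ1 : r₂ / r₁ * δ ≤ 1 / 8) (hε : 0 ≤ ε) (hε1 : ε ≤ 1 / 16) (hc : 0 < c)
    (hE : 6 * (r₂ / r₁ * δ) + 4 * ε ≤ E) (hE0 : 0 < E)
    (hmax : ∀ i, gauge K (X (Fin.castAdd M i)) ≤ L)
    (hδcap : ∀ u, ‖u‖ = 1 →
      k ≤ (Finset.univ.filter fun m => ‖unitDir (X (Fin.natAdd n m)) - u‖ ≤ δ).card)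
    (hηdir : ∀ u, ‖u‖ = 1 →
      (Finset.univ.filter fun m => ‖unitDir (X (Fin.natAdd n m)) - u‖ ≤ 2 * η).card ≤ k)
    (hηobs : ∀ u, ‖u‖ = 1 →
      N ≤ (Finset.univ.filter fun i => ‖unitDir (X (Fin.castAdd M i)) - u‖ ≤ η).card)
    (havg : ∀ m, N ≤ (nearIndices k (fun i => unitDir (X (Fin.castAdd M i)))
        (fun m => unitDir (X (Fin.natAdd n m))) m).card →
      |∑ i ∈ nearIndices k (fun i => unitDir (X (Fin.castAdd M i)))
          (fun m => unitDir (X (Fin.natAdd n m))) m, min (gauge K (X (Fin.castAdd M i))) L -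
        (nearIndices k (fun i => unitDir (X (Fin.castAdd M i)))
          (fun m => unitDir (X (Fin.natAdd n m))) m).card * c| ≤
        (nearIndices k (fun i => unitDir (X (Fin.castAdd M i)))
          (fun m => unitDir (X (Fin.natAdd n m))) m).card * (ε * c)) :
    (⨅ (α : ℝ) (_ : 0 < α), dScale (α • estimateK X) K) ≤ ENNReal.ofReal E := by
  have : Nonempty (Fin M) := ⟨⟨0, by omega⟩⟩
  have hu : ∀ i : Fin n, ‖unitDir (X (Fin.castAdd M i))‖ = 1 := fun i => norm_unitDir (hX _)
  have hθ : ∀ m : Fin M, ‖unitDir (X (Fin.natAdd n m))‖ = 1 := fun m => norm_unitDir (hX _)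
  have hsel : ∀ m, coneIndices X m = nearIndices k (fun i => unitDir (X (Fin.castAdd M i)))
      (fun m => unitDir (X (Fin.natAdd n m))) m := by
    intro m
    subst hkn
    exact coneIndices_eq_nearIndices X hX hk hkM m
  have hcard : ∀ m, N ≤ (coneIndices X m).card := by
    intro m
    rw [hsel m]
    exact (hηobs _ (hθ m)).trans
      (Finset.card_le_card (filter_subset_nearIndices hu hθ (hηdir _ (hθ m))))
  have hbounds := fun m => radius_mul_gauge_bounds hK h₁ h₂ hb₁ hb₂ X hX m (δ := δ) (ε := ε)
    (c := c) (by linarith) hε hc (lt_of_lt_of_le hN (hcard m))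
    (fun i hi => by
      rw [hsel m] at hi
      exact norm_sub_le_of_mem_nearIndices hu hθ hi (hδcap _ (hu i)))
    (by
      have h := havg m (by rw [← hsel m]; exact hcard m)
      rw [← hsel m] at h
      simpa only [min_eq_left (hmax _)] using h)
  refine iInf₂_le_of_le c⁻¹ (inv_pos.2 hc) ?_
  have hset : c⁻¹ • estimateK X =
      convexHull ℝ (Set.range fun m => (c⁻¹ * radius X m) • direction X m) := by
    rw [estimateK, ← convexHull_smul]
    congr 1
    ext y
    simp [Set.mem_smul_set, smul_smul]
  rw [hset]
  refine dScale_convexHull_le hK h₁ h₂ hb₁ hb₂ hθ (a := r₂ / r₁ * δ + 2 * ε) (δ := δ)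
    (by linarith) hδ0 hδ1 (fun u hu => ?_) (fun m => ?_) (fun m => (hbounds m).1)
    (fun m => (hbounds m).2) (by linarith) hE0
  · obtain ⟨m, hm⟩ := Finset.card_pos.1 (lt_of_lt_of_le hk (hδcap u hu))
    exact ⟨m, (Finset.mem_filter.1 hm).2⟩
  · have : 0 ≤ radius X m := by
      rw [radius]
      exact mul_nonneg (by positivity) (Finset.sum_nonneg fun _ _ => norm_nonneg _)
    positivity

end Typical

/-! ### The probability of a typical sample -/

/-- The features of the sampling law that matter: gauge and direction are independent, caps of
directions have probability of order `r ^ (p - 1)`, and the gauge has scale `t` with an exponential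
tail. -/
structure IsPolarLaw {p : ℕ} (K : Set (EuclideanSpace ℝ (Fin p)))
    (μ : Measure (EuclideanSpace ℝ (Fin p))) (c C A t : ℝ) : Prop where
  isProbabilityMeasure : IsProbabilityMeasure μ
  apply_zero : μ {0} = 0
  indepFun : IndepFun (gauge K) unitDir μ
  le_cap : ∀ u, ‖u‖ = 1 → ∀ r, 0 < r → r ≤ 1 → c * r ^ (p - 1) ≤ μ.real (capCone u r)
  cap_le : ∀ u, ‖u‖ = 1 → ∀ r, 0 < r → r ≤ 1 → μ.real (capCone u r) ≤ C * r ^ (p - 1)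
  scale_pos : 0 < t
  median : μ.real {x | gauge K x < t / 4} ≤ 1 / 2
  tail : ∀ s : ℝ, μ.real {x | s < gauge K x} ≤ A * Real.exp (-(s / (4 * t)))

section TypicalProbability

variable {p : ℕ} {K : Set (EuclideanSpace ℝ (Fin p))}

lemma IsHomotheticLogConcaveDensity.exists_isPolarLaw (hp : 2 ≤ p) (hK : IsBodyAroundZero K)
    {r₁ r₂ : ℝ} (h₁ : 0 < r₁) (h₂ : r₁ ≤ r₂)
    (hb₁ : Metric.closedBall 0 r₁ ⊆ K) (hb₂ : K ⊆ Metric.closedBall 0 r₂)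
    {f : EuclideanSpace ℝ (Fin p) → ℝ≥0∞} (hf : IsHomotheticLogConcaveDensity K f) :
    ∃ t, IsPolarLaw K (volume.withDensity f) ((8 * (r₂ / r₁))⁻¹ ^ p) (3 * (3 * (r₂ / r₁)) ^ p)
      (tailConst p (r₂ / r₁)) t := by
  obtain ⟨⟨φ, hφ, hfφ⟩, hint⟩ := hf
  have hfeq : f = fun x => profile φ (gauge K x) := by
    ext x
    rw [hfφ x, profile]
    congr 2
    exact (Real.toNNReal_of_nonneg (gauge_nonneg x)).symm
  have hP : IsProbabilityMeasure (volume.withDensity f) :=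
    ⟨by rw [withDensity_apply _ MeasurableSet.univ, Measure.restrict_univ, hint]⟩
  have hzero : (volume.withDensity f) {0} = 0 := by
    have : Nonempty (Fin p) := ⟨⟨0, by omega⟩⟩
    exact withDensity_absolutelyContinuous _ _ (measure_singleton 0)
  subst hfeq
  have hh := hφ.measurable_profile
  obtain ⟨t, ht, hmed, htail⟩ := exists_scale_radial_bounds hp hK hφ h₁ h₂ hb₁ hb₂
  exact ⟨t, hP, hzero, indepFun_gauge_unitDir hK hh,
    fun u hu r hr hr1 => le_prob_capCone (by omega) hK hh h₁ h₂ hb₁ hb₂ hu hr hr1,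
    fun u hu r hr hr1 => prob_capCone_le (by omega) hK hh h₁ h₂ hb₁ hb₂ hu hr hr1,
    ht, hmed, htail⟩

variable {n M : ℕ}

lemma measurableSet_nearIndices_eq (k : ℕ) (m : Fin M) (I : Finset (Fin n)) :
    MeasurableSet ((fun u : Fin (n + M) → EuclideanSpace ℝ (Fin p) =>
      nearIndices k (fun i => u (Fin.castAdd M i)) (fun m => u (Fin.natAdd n m)) m) ⁻¹' {I}) := by
  have hi : ∀ i : Fin n, MeasurableSet {u : Fin (n + M) → EuclideanSpace ℝ (Fin p) |
      i ∈ nearIndices k (fun i => u (Fin.castAdd M i)) (fun m => u (Fin.natAdd n m)) m} := by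
    intro i
    simp only [nearIndices, Finset.mem_filter, Finset.mem_univ, true_and, Finset.card_filter]
    refine measurableSet_lt (Finset.measurable_sum _ fun m' _ => ?_) measurable_const
    refine Measurable.ite (measurableSet_lt ?_ ?_) measurable_const measurable_const
    · exact (measurable_pi_apply _).inner (measurable_pi_apply _)
    · exact (measurable_pi_apply _).inner (measurable_pi_apply _)
  have : ((fun u : Fin (n + M) → EuclideanSpace ℝ (Fin p) =>
      nearIndices k (fun i => u (Fin.castAdd M i)) (fun m => u (Fin.natAdd n m)) m) ⁻¹' {I}) =
      ⋂ i : Fin n, {u | i ∈ nearIndices k (fun i => u (Fin.castAdd M i))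
        (fun m => u (Fin.natAdd n m)) m ↔ i ∈ I} := by
    ext u
    simp [Finset.ext_iff]
  rw [this]
  refine MeasurableSet.iInter fun i => ?_
  by_cases h : i ∈ I
  · simpa [h] using hi i
  · simp only [h, iff_false]
    exact (hi i).compl

variable {Ω : Type*} [MeasurableSpace Ω] {P : Measure Ω} [IsProbabilityMeasure P]
  {μ : Measure (EuclideanSpace ℝ (Fin p))} {c₀ C A t : ℝ}
  {X : Fin (n + M) → Ω → EuclideanSpace ℝ (Fin p)}

/-- The truncated gauge has mean of order at least the scale `t`. -/
lemma IsPolarLaw.le_integral_min (hK : IsBodyAroundZero K) (hμ : IsPolarLaw K μ c₀ C A t) {L : ℝ}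
    (hL : t / 4 ≤ L) : t / 8 ≤ ∫ x, min (gauge K x) L ∂μ := by
  have := hμ.isProbabilityMeasure
  have ht := hμ.scale_pos
  have hg := hK.continuous_gauge.measurable
  have hm : MeasurableSet {x | gauge K x < t / 4} := measurableSet_lt hg measurable_const
  have hbd : ∀ x, min (gauge K x) L ∈ Set.Icc 0 L := fun x =>
    ⟨le_min (gauge_nonneg x) (by linarith), min_le_right _ _⟩
  have hint : Integrable (fun x => min (gauge K x) L) μ :=
    Integrable.of_mem_Icc 0 L (hg.min measurable_const).aemeasurable
      (Filter.Eventually.of_forall hbd)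
  have h1 : ∫ x, {x | gauge K x < t / 4}ᶜ.indicator (fun _ => t / 4) x ∂μ ≤
      ∫ x, min (gauge K x) L ∂μ := by
    refine integral_mono ((integrable_const _).indicator hm.compl) hint fun x => ?_
    by_cases hx : gauge K x < t / 4
    · simpa [hx] using (hbd x).1
    · simpa [hx] using ⟨not_lt.1 hx, hL⟩
  rw [integral_indicator_const _ hm.compl, smul_eq_mul, probReal_compl_eq_one_sub hm] at h1
  have := hμ.median
  nlinarith

/-- Averages of truncated gauges over the selected observations concentrate, uniformly over the
directions: the selection depends on the directions only, hence is independent of the gauges. -/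
lemma prob_selected_average_le (hK : IsBodyAroundZero K) (hμ : IsPolarLaw K μ c₀ C A t)
    (hX : ∀ i, Measurable (X i)) (hind : iIndepFun X P) (hlaw : ∀ i, P.map (X i) = μ)
    (k : ℕ) {N : ℕ} (hN : 1 ≤ N) {L a : ℝ} (hL : 0 < L) (ha : 0 ≤ a) :
    P.real {ω | ∃ m : Fin M, N ≤ (nearIndices k (fun i => unitDir (X (Fin.castAdd M i) ω))
          (fun m => unitDir (X (Fin.natAdd n m) ω)) m).card ∧
        (nearIndices k (fun i => unitDir (X (Fin.castAdd M i) ω))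
          (fun m => unitDir (X (Fin.natAdd n m) ω)) m).card * a ≤
        |∑ i ∈ nearIndices k (fun i => unitDir (X (Fin.castAdd M i) ω))
          (fun m => unitDir (X (Fin.natAdd n m) ω)) m, min (gauge K (X (Fin.castAdd M i) ω)) L -
        (nearIndices k (fun i => unitDir (X (Fin.castAdd M i) ω))
          (fun m => unitDir (X (Fin.natAdd n m) ω)) m).card * ∫ x, min (gauge K x) L ∂μ|} ≤
      M * (2 * Real.exp (-(2 * N * a ^ 2 / L ^ 2))) := by
  have := hμ.isProbabilityMeasure
  have hg := hK.continuous_gauge.measurable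
  have hgL : Measurable fun x => min (gauge K x) L := hg.min measurable_const
  set c := ∫ x, min (gauge K x) L ∂μ
  let sel : Fin M → (Fin (n + M) → EuclideanSpace ℝ (Fin p)) → Finset (Fin n) := fun m u =>
    nearIndices k (fun i => u (Fin.castAdd M i)) (fun m => u (Fin.natAdd n m)) m
  let V : Ω → Fin (n + M) → EuclideanSpace ℝ (Fin p) := fun ω j => unitDir (X j ω)
  let W : Ω → Fin (n + M) → ℝ := fun ω j => gauge K (X j ω)
  let bad : Finset (Fin n) → Set (Fin (n + M) → ℝ) := fun I =>
    {w | N ≤ I.card ∧ I.card * a ≤ |∑ i ∈ I, min (w (Fin.castAdd M i)) L - I.card * c|}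
  have hV : Measurable V := measurable_pi_lambda _ fun j => measurable_unitDir.comp (hX j)
  have hVW : IndepFun V W P :=
    (indepFun_pi_of_indepFun hX hind hlaw hg measurable_unitDir hμ.indepFun).symm
  have hbadm : ∀ I, MeasurableSet (bad I) := by
    intro I
    have hsum : Measurable fun w : Fin (n + M) → ℝ => ∑ i ∈ I, min (w (Fin.castAdd M i)) L :=
      Finset.measurable_sum _ fun i _ => (measurable_pi_apply _).min measurable_const
    have hset : MeasurableSet {w : Fin (n + M) → ℝ |
        I.card * a ≤ |∑ i ∈ I, min (w (Fin.castAdd M i)) L - I.card * c|} :=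
      measurableSet_le measurable_const (hsum.sub_const _).abs
    exact (MeasurableSet.const (N ≤ I.card)).inter hset
  have hone : ∀ I, P.real (W ⁻¹' bad I) ≤ 2 * Real.exp (-(2 * N * a ^ 2 / L ^ 2)) := by
    intro I
    by_cases hI : N ≤ I.card
    · have hZ : ∀ i : Fin n, Measurable fun ω => min (gauge K (X (Fin.castAdd M i) ω)) L :=
        fun i => hgL.comp (hX _)
      have hZind : iIndepFun (fun (i : Fin n) ω => min (gauge K (X (Fin.castAdd M i) ω)) L) P :=
        (hind.precomp (Fin.castAdd_injective n M)).comp (fun _ x => min (gauge K x) L)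
          fun _ => hgL
      have hmean : ∀ i : Fin n, ∫ ω, min (gauge K (X (Fin.castAdd M i) ω)) L ∂P = c := by
        intro i
        change _ = ∫ x, min (gauge K x) L ∂μ
        rw [← hlaw (Fin.castAdd M i), integral_map (hX _).aemeasurable
          hgL.aestronglyMeasurable]
      have h := prob_abs_sum_sub_le hZind hZ hL (fun i ω =>
        ⟨le_min (gauge_nonneg _) hL.le, min_le_right _ _⟩) hmean ha (I := I) (by omega)
      refine (measureReal_mono (fun ω hω => hω.2) (measure_ne_top _ _)).trans (h.trans ?_)
      have hI' : (N : ℝ) ≤ I.card := by exact_mod_cast hI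
      gcongr
    · have : W ⁻¹' bad I = ∅ := by
        ext ω; simp [bad, hI]
      rw [this, measureReal_empty]
      positivity
  refine (measureReal_mono (s₂ := ⋃ m ∈ (Finset.univ : Finset (Fin M)),
    {ω | W ω ∈ bad (sel m (V ω))}) ?_ (measure_ne_top _ _)).trans
    ((measureReal_biUnion_finset_le _ _).trans ?_)
  · rintro ω ⟨m, hm⟩
    exact Set.mem_iUnion₂.2 ⟨m, Finset.mem_univ _, hm⟩
  · refine (Finset.sum_le_sum fun m _ => prob_selection_le hVW
      (measurableSet_nearIndices_eq k m) hbadm hV (by positivity) hone).trans ?_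
    simp

lemma IsPolarLaw.prob_exists_gauge_gt_le (hK : IsBodyAroundZero K) (hμ : IsPolarLaw K μ c₀ C A t)
    (hX : ∀ i, Measurable (X i)) (hlaw : ∀ i, P.map (X i) = μ) (L : ℝ) :
    P.real {ω | ∃ i : Fin n, L < gauge K (X (Fin.castAdd M i) ω)} ≤
      n * (A * Real.exp (-(L / (4 * t)))) := by
  have hm : MeasurableSet {x | L < gauge K x} :=
    measurableSet_lt measurable_const hK.continuous_gauge.measurable
  refine (measureReal_mono (s₂ := ⋃ i ∈ (Finset.univ : Finset (Fin n)),
    X (Fin.castAdd M i) ⁻¹' {x | L < gauge K x}) ?_ (measure_ne_top _ _)).trans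
    ((measureReal_biUnion_finset_le _ _).trans ?_)
  · rintro ω ⟨i, hi⟩
    exact Set.mem_iUnion₂.2 ⟨i, Finset.mem_univ _, hi⟩
  · refine (Finset.sum_le_sum fun i _ => ?_).trans_eq
      (b := ∑ _i : Fin n, A * Real.exp (-(L / (4 * t)))) (by simp)
    rw [← map_measureReal_apply (hX _) hm, hlaw]
    exact hμ.tail L

lemma IsPolarLaw.prob_exists_eq_zero {P : Measure Ω} (hμ : IsPolarLaw K μ c₀ C A t)
    (hX : ∀ i, Measurable (X i)) (hlaw : ∀ i, P.map (X i) = μ) :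
    P.real {ω | ∃ j, X j ω = 0} = 0 := by
  have : {ω | ∃ j, X j ω = 0} = ⋃ j, X j ⁻¹' {0} := by ext ω; simp
  rw [Measure.real, this, measure_iUnion_null, ENNReal.toReal_zero]
  intro j
  rw [← Measure.map_apply (hX j) (measurableSet_singleton 0), hlaw]
  exact hμ.apply_zero

/-- The failure probability of the error bound, in terms of the radii `δ`, `η` of the caps, the
truncation level `L`, the minimal selection size `N` and the relative accuracy `ε`. -/
lemma one_le_prob_add_of_isPolarLaw (hK : IsBodyAroundZero K) (hμ : IsPolarLaw K μ c₀ C A t)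
    (hX : ∀ i, Measurable (X i)) (hind : iIndepFun X P) (hlaw : ∀ i, P.map (X i) = μ)
    {r₁ r₂ : ℝ} (h₁ : 0 < r₁) (h₂ : r₁ ≤ r₂)
    (hb₁ : Metric.closedBall 0 r₁ ⊆ K) (hb₂ : K ⊆ Metric.closedBall 0 r₂) {k N : ℕ}
    (hkn : ⌊Real.log n⌋₊ = k) (hk : 1 ≤ k) (hkM : k ≤ M) (hN : 1 ≤ N) {δ η ε L E l : ℝ}
    (hδ0 : 0 < δ) (hδ' : δ ≤ 1) (hδ1 : r₂ / r₁ * δ ≤ 1 / 8) (hη0 : 0 < η) (hη1 : 4 * η ≤ 1)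
    (hε : 0 ≤ ε) (hε1 : ε ≤ 1 / 16) (hL : t / 4 ≤ L)
    (hE : 6 * (r₂ / r₁ * δ) + 4 * ε ≤ E) (hE0 : 0 < E) (hl : 0 ≤ l) :
    1 ≤ P.real {ω | (⨅ (α : ℝ) (_ : 0 < α), dScale (α • estimateK (fun i => X i ω)) K) ≤
          ENNReal.ofReal E} +
        n * (A * Real.exp (-(L / (4 * t)))) +
        (8 / δ) ^ p * Real.exp (k - M * (c₀ * (δ / 2) ^ (p - 1)) / 2) +
        (4 / (2 * η)) ^ p *
          Real.exp (M * (C * (2 * (2 * η)) ^ (p - 1)) * (Real.exp l - 1) - l * k) +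
        (8 / η) ^ p * Real.exp (N - n * (c₀ * (η / 2) ^ (p - 1)) / 2) +
        M * (2 * Real.exp (-(2 * N * (ε * (t / 8)) ^ 2 / L ^ 2))) := by
  have ht := hμ.scale_pos
  have hcm := hμ.le_integral_min hK hL
  set c := ∫ x, min (gauge K x) L ∂μ with hc
  have hc0 : 0 < c := lt_of_lt_of_le (by positivity) hcm
  have hL0 : 0 < L := by linarith
  have b1 := hμ.prob_exists_gauge_gt_le (n := n) (M := M) hK hX hlaw L
  have b2 := prob_exists_cap_few_le (fun m : Fin M => hX (Fin.natAdd n m))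
    (hind.precomp (Fin.natAdd_injective M n)) (fun m => hlaw _) hδ0 hδ'
    (fun u hu => hμ.le_cap u hu (δ / 2) (by positivity) (by linarith)) k
  have b3 := prob_exists_cap_many_le (fun m : Fin M => hX (Fin.natAdd n m))
    (hind.precomp (Fin.natAdd_injective M n)) (fun m => hlaw _) (r := 2 * η) (by positivity)
    (by linarith) (fun u hu => hμ.cap_le u hu (2 * (2 * η)) (by positivity) (by linarith)) k hl
  have b4 := prob_exists_cap_few_le (fun i : Fin n => hX (Fin.castAdd M i))
    (hind.precomp (Fin.castAdd_injective n M)) (fun m => hlaw _) hη0 (by linarith)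
    (fun u hu => hμ.le_cap u hu (η / 2) (by positivity) (by linarith)) N
  have b5 := prob_selected_average_le hK hμ hX hind hlaw k hN hL0
    (by positivity : 0 ≤ ε * (t / 8))
  have b0 := hμ.prob_exists_eq_zero hX hlaw
  rw [Fintype.card_fin] at b2 b3 b4
  set S := {ω | (⨅ (α : ℝ) (_ : 0 < α), dScale (α • estimateK (fun i => X i ω)) K) ≤
    ENNReal.ofReal E}
  set S0 := {ω | ∃ j, X j ω = 0}
  set S1 := {ω | ∃ i : Fin n, L < gauge K (X (Fin.castAdd M i) ω)}
  set S2 := {ω | ∃ u, ‖u‖ = 1 ∧ (Finset.univ.filter fun m =>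
    ‖unitDir (X (Fin.natAdd n m) ω) - u‖ ≤ δ).card < k}
  set S3 := {ω | ∃ u, ‖u‖ = 1 ∧ k < (Finset.univ.filter fun m =>
    ‖unitDir (X (Fin.natAdd n m) ω) - u‖ ≤ 2 * η).card}
  set S4 := {ω | ∃ u, ‖u‖ = 1 ∧ (Finset.univ.filter fun i =>
    ‖unitDir (X (Fin.castAdd M i) ω) - u‖ ≤ η).card < N}
  set S5 := {ω | ∃ m : Fin M, N ≤ (nearIndices k (fun i => unitDir (X (Fin.castAdd M i) ω))
      (fun m => unitDir (X (Fin.natAdd n m) ω)) m).card ∧ _}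
  have hcover : (Set.univ : Set Ω) ⊆ S ∪ S0 ∪ S1 ∪ S2 ∪ S3 ∪ S4 ∪ S5 := by
    intro ω _
    by_contra hω
    simp only [Set.mem_union, not_or] at hω
    obtain ⟨⟨⟨⟨⟨⟨n0, n1⟩, n2⟩, n3⟩, n4⟩, n5⟩, n6⟩ := hω
    refine n0 (iInf_dScale_le_of_typical hK h₁ h₂ hb₁ hb₂ (fun i => X i ω)
      (fun j hj => n1 ⟨j, hj⟩) hkn hk hkM hN hδ0.le hδ1 hε hε1 hc0 hE hE0
      (L := L) (η := η) (fun i => not_lt.1 fun hi => n2 ⟨i, hi⟩)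
      (fun u hu => not_lt.1 fun h => n3 ⟨u, hu, h⟩)
      (fun u hu => not_lt.1 fun h => n4 ⟨u, hu, h⟩)
      (fun u hu => not_lt.1 fun h => n5 ⟨u, hu, h⟩) fun m hm => ?_)
    by_contra! h
    refine n6 ⟨m, hm, le_trans ?_ h.le⟩
    gcongr
  have hle := measureReal_mono (μ := P) hcover (measure_ne_top _ _)
  rw [probReal_univ] at hle
  have u1 := measureReal_union_le (μ := P) (S ∪ S0 ∪ S1 ∪ S2 ∪ S3 ∪ S4) S5
  have u2 := measureReal_union_le (μ := P) (S ∪ S0 ∪ S1 ∪ S2 ∪ S3) S4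
  have u3 := measureReal_union_le (μ := P) (S ∪ S0 ∪ S1 ∪ S2) S3
  have u4 := measureReal_union_le (μ := P) (S ∪ S0 ∪ S1) S2
  have u5 := measureReal_union_le (μ := P) (S ∪ S0) S1
  have u6 := measureReal_union_le (μ := P) S S0
  linarith

end TypicalProbability

/-! ### The choice of parameters -/

section Rates

variable {p n : ℕ}

/-- The resolution `n ^ (-1 / (p + 1))` of the `numDirections p n` random directions. -/
noncomputable def resolution (p n : ℕ) : ℝ := (n : ℝ) ^ (-(1 / ((p : ℝ) + 1)))

lemma resolution_pos (hn : 1 ≤ n) : 0 < resolution p n :=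
  Real.rpow_pos_of_pos (by exact_mod_cast hn) _

lemma resolution_le_one (hn : 1 ≤ n) : resolution p n ≤ 1 := by
  refine Real.rpow_le_one_of_one_le_of_nonpos (by exact_mod_cast hn) ?_
  have : 0 ≤ 1 / ((p : ℝ) + 1) := by positivity
  linarith

lemma mul_resolution_pow (hn : 1 ≤ n) : (n : ℝ) * resolution p n ^ (p + 1) = 1 := by
  have hn' : (0 : ℝ) < n := by exact_mod_cast hn
  rw [resolution, ← Real.rpow_natCast, ← Real.rpow_mul hn'.le]
  have : -(1 / ((p : ℝ) + 1)) * ((p + 1 : ℕ) : ℝ) = -1 := by push_cast; field_simp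
  rw [this, Real.rpow_neg_one, mul_inv_cancel₀ hn'.ne']

lemma mul_resolution_pow_pred (hp : 1 ≤ p) (hn : 1 ≤ n) :
    (n : ℝ) * resolution p n ^ (p - 1) = (resolution p n ^ 2)⁻¹ := by
  have h := mul_resolution_pow (p := p) hn
  have hη := resolution_pos (p := p) hn
  obtain ⟨q, rfl⟩ : ∃ q, p = q + 1 := ⟨p - 1, by omega⟩
  rw [Nat.add_sub_cancel]
  refine eq_inv_of_mul_eq_one_left ?_
  rw [mul_assoc, ← pow_add]
  exact h

lemma rpow_mul_resolution_pow (hp : 1 ≤ p) (hn : 1 ≤ n) :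
    (n : ℝ) ^ (((p : ℝ) - 1) / ((p : ℝ) + 1)) * resolution p n ^ (p - 1) = 1 := by
  have hn' : (0 : ℝ) < n := by exact_mod_cast hn
  rw [resolution, ← Real.rpow_natCast, ← Real.rpow_mul hn'.le, ← Real.rpow_add hn']
  have : ((p : ℝ) - 1) / ((p : ℝ) + 1) + -(1 / ((p : ℝ) + 1)) * ((p - 1 : ℕ) : ℝ) = 0 := by
    rw [Nat.cast_sub hp]; push_cast; field_simp; ring
  rw [this, Real.rpow_zero]

lemma one_le_numDirections_mul (hp : 1 ≤ p) (hn : 1 ≤ n) :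
    1 ≤ (numDirections p n : ℝ) * resolution p n ^ (p - 1) := by
  have hη := resolution_pos (p := p) hn
  rw [← rpow_mul_resolution_pow hp hn]
  exact mul_le_mul_of_nonneg_right (Nat.le_ceil _) (by positivity)

lemma numDirections_mul_le (hp : 1 ≤ p) (hn : 1 ≤ n) :
    (numDirections p n : ℝ) * resolution p n ^ (p - 1) ≤ 2 := by
  have hη := resolution_pos (p := p) hn
  have h1 : (numDirections p n : ℝ) ≤ (n : ℝ) ^ (((p : ℝ) - 1) / ((p : ℝ) + 1)) + 1 :=
    (Nat.ceil_lt_add_one (Real.rpow_nonneg (Nat.cast_nonneg n) _)).le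
  have h2 : resolution p n ^ (p - 1) ≤ 1 := pow_le_one₀ hη.le (resolution_le_one hn)
  have h3 := mul_le_mul_of_nonneg_right h1 (pow_nonneg hη.le (p - 1))
  rw [add_mul, rpow_mul_resolution_pow hp hn] at h3
  linarith

lemma numDirections_le (hn : 1 ≤ n) : numDirections p n ≤ n := by
  refine Nat.ceil_le.2 ?_
  have hn' : (1 : ℝ) ≤ n := by exact_mod_cast hn
  calc (n : ℝ) ^ (((p : ℝ) - 1) / ((p : ℝ) + 1)) ≤ (n : ℝ) ^ (1 : ℝ) := by
        refine Real.rpow_le_rpow_of_exponent_le hn' ?_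
        rw [div_le_one (by positivity)]; linarith
    _ = n := Real.rpow_one _

lemma div_resolution_pow_le (hn : 1 ≤ n) {b : ℝ} (hb : 0 ≤ b) :
    (b / resolution p n) ^ p ≤ b ^ p * n := by
  have hη := resolution_pos (p := p) hn
  rw [div_pow, div_le_iff₀ (by positivity), mul_assoc]
  refine le_mul_of_one_le_right (by positivity) ?_
  rw [← mul_resolution_pow (p := p) hn, pow_succ]
  have : 0 ≤ (n : ℝ) * resolution p n ^ p := by positivity
  nlinarith [resolution_le_one (p := p) hn]

lemma scaleRate_eq (hn : 1 ≤ n) (r₀ : ℝ) :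
    scaleRate p n r₀ = r₀ ^ 2 * resolution p n * (1 + Real.log n) ^ 3 := by
  have hn' : (n : ℝ) ≠ 0 := by positivity
  rw [scaleRate, Real.log_mul (Real.exp_pos 1).ne' hn', Real.log_exp]
  rfl

lemma eight_pow_le (p : ℕ) : (8 : ℝ) ^ p ≤ Real.exp (3 * p) := by
  have h : (8 : ℝ) ≤ Real.exp 3 := by
    have h1 := Real.exp_one_gt_d9
    have h2 : Real.exp 3 = Real.exp 1 ^ 3 := by rw [← Real.exp_nat_mul]; norm_num
    rw [h2]
    calc (8 : ℝ) = 2 ^ 3 := by norm_num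
      _ ≤ Real.exp 1 ^ 3 := pow_le_pow_left₀ (by norm_num) (by linarith) 3
  calc (8 : ℝ) ^ p ≤ Real.exp 3 ^ p := pow_le_pow_left₀ (by norm_num) h p
    _ = Real.exp (3 * p) := by rw [← Real.exp_nat_mul]; ring_nf

/-! ### The failure terms -/

variable {c₀ C : ℝ}

/-- A cap of radius `log² n * η` is expected to hold at least order `log² n` directions, so its
Chernoff bound `exp (-c * log² n)` beats every power of `n`. -/
lemma few_directions_term_le (hp : 2 ≤ p) (hn : 1 ≤ n) (hc₀ : 0 < c₀) (hℓ : 2 ≤ Real.log n)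
    (hlarge : 3 * p + 1 + 3 * Real.log n ≤ c₀ / 4 * Real.log n ^ 2) :
    (8 / (Real.log n ^ 2 * resolution p n)) ^ p *
        Real.exp (⌊Real.log n⌋₊ - numDirections p n *
          (c₀ * (Real.log n ^ 2 * resolution p n / 2) ^ (p - 1)) / 2) ≤ 1 / n := by
  have hη := resolution_pos (p := p) hn
  have hn' : (0 : ℝ) < n := by exact_mod_cast hn
  set η := resolution p n
  set ℓ := Real.log n with hℓd
  have hexp : Real.exp ℓ = n := Real.exp_log hn'
  have hpre : (8 / (ℓ ^ 2 * η)) ^ p ≤ Real.exp (3 * p) * n := by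
    calc (8 / (ℓ ^ 2 * η)) ^ p ≤ (8 / η) ^ p := by
          gcongr
          exact le_mul_of_one_le_left hη.le (by nlinarith)
      _ ≤ 8 ^ p * n := div_resolution_pow_le hn (by norm_num)
      _ ≤ _ := by gcongr; exact eight_pow_le p
  have hk : (⌊ℓ⌋₊ : ℝ) ≤ ℓ := Nat.floor_le (by linarith)
  have hM := one_le_numDirections_mul (p := p) (by omega) hn
  have hpow : ℓ ^ 2 / 2 ≤ (numDirections p n : ℝ) * (ℓ ^ 2 * η / 2) ^ (p - 1) := by
    have h1 : (ℓ ^ 2 * η / 2) ^ (p - 1) = (ℓ ^ 2 / 2) ^ (p - 1) * η ^ (p - 1) := by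
      rw [← mul_pow]; ring_nf
    have h2 : ℓ ^ 2 / 2 ≤ (ℓ ^ 2 / 2) ^ (p - 1) := le_self_pow₀ (by nlinarith) (by omega)
    rw [h1]
    calc ℓ ^ 2 / 2 ≤ (ℓ ^ 2 / 2) ^ (p - 1) * 1 := by linarith
      _ ≤ (ℓ ^ 2 / 2) ^ (p - 1) * (numDirections p n * η ^ (p - 1)) := by gcongr
      _ = _ := by ring
  have hexpo : (⌊ℓ⌋₊ : ℝ) - numDirections p n * (c₀ * (ℓ ^ 2 * η / 2) ^ (p - 1)) / 2 ≤
      ℓ - c₀ / 4 * ℓ ^ 2 := by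
    have := mul_le_mul_of_nonneg_left hpow hc₀.le
    linarith
  calc _ ≤ (Real.exp (3 * p) * n) * Real.exp (ℓ - c₀ / 4 * ℓ ^ 2) := by gcongr
    _ = Real.exp (3 * p + ℓ + (ℓ - c₀ / 4 * ℓ ^ 2)) := by
        rw [← hexp, ← Real.exp_add, ← Real.exp_add]
    _ ≤ Real.exp (-ℓ) := by rw [Real.exp_le_exp]; linarith
    _ = 1 / n := by rw [Real.exp_neg, hexp, one_div]

/-- The Chernoff exponent `3` makes a net of order `n` points affordable: each contributes a term
of order `exp (-3 * log n)`. -/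
lemma many_directions_term_le (hp : 2 ≤ p) (hn : 1 ≤ n) (hC : 0 ≤ C) :
    (4 / (2 * resolution p n)) ^ p *
        Real.exp (numDirections p n * (C * (2 * (2 * resolution p n)) ^ (p - 1)) *
          (Real.exp 3 - 1) - 3 * ⌊Real.log n⌋₊) ≤
      2 ^ p * Real.exp (2 * C * 4 ^ (p - 1) * Real.exp 3 + 3) / n := by
  have hη := resolution_pos (p := p) hn
  have hn' : (0 : ℝ) < n := by exact_mod_cast hn
  have hn1 : (1 : ℝ) ≤ n := by exact_mod_cast hn
  set η := resolution p n
  set ℓ := Real.log n with hℓd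
  have hexp : Real.exp ℓ = n := Real.exp_log hn'
  have hpre : (4 / (2 * η)) ^ p ≤ 2 ^ p * n := by
    rw [show 4 / (2 * η) = 2 / η by field_simp; norm_num]
    exact div_resolution_pow_le hn (by norm_num)
  have hk : ℓ - 1 ≤ ⌊ℓ⌋₊ := by linarith [Nat.lt_floor_add_one ℓ]
  have hM := numDirections_mul_le (p := p) (by omega) hn
  have hM' : (numDirections p n : ℝ) * (C * (2 * (2 * η)) ^ (p - 1)) ≤ 2 * C * 4 ^ (p - 1) := by
    calc (numDirections p n : ℝ) * (C * (2 * (2 * η)) ^ (p - 1))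
        = C * 4 ^ (p - 1) * (numDirections p n * η ^ (p - 1)) := by
          rw [show 2 * (2 * η) = 4 * η by ring, mul_pow]; ring
      _ ≤ C * 4 ^ (p - 1) * 2 := by gcongr
      _ = _ := by ring
  have hexpo : (numDirections p n : ℝ) * (C * (2 * (2 * η)) ^ (p - 1)) * (Real.exp 3 - 1)
      - 3 * ⌊ℓ⌋₊ ≤ 2 * C * 4 ^ (p - 1) * Real.exp 3 + 3 - 3 * ℓ := by
    have h3 : 0 ≤ Real.exp 3 - 1 := sub_nonneg.2 (Real.one_le_exp (by norm_num))
    have h4 := mul_le_mul_of_nonneg_right hM' h3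
    have h5 : 0 ≤ 2 * C * 4 ^ (p - 1) := by positivity
    linarith
  have hneg : Real.exp (-(3 * ℓ)) = 1 / (n : ℝ) ^ 3 := by
    rw [Real.exp_neg, ← hexp, ← Real.exp_nat_mul, one_div]; norm_num
  calc _ ≤ (2 ^ p * n) * Real.exp (2 * C * 4 ^ (p - 1) * Real.exp 3 + 3 - 3 * ℓ) := by gcongr
    _ = 2 ^ p * Real.exp (2 * C * 4 ^ (p - 1) * Real.exp 3 + 3) / n * (1 / n) := by
        rw [sub_eq_add_neg, Real.exp_add _ (-(3 * ℓ)), hneg]; field_simp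
    _ ≤ _ := mul_le_of_le_one_right (by positivity) (by rwa [div_le_one hn'])

/-- A cap of radius `η` is expected to hold order `n * η ^ (p - 1) = η⁻²` observations, and
`N` is a fraction of that. -/
lemma few_observations_term_le (hp : 2 ≤ p) (hn : 1 ≤ n) (hc₀ : 0 < c₀)
    (hℓη : Real.log n * resolution p n ≤ 1)
    (hℓ : 0 ≤ Real.log n)
    (hlarge : 3 * p + 1 + 3 * Real.log n ≤ c₀ * 2⁻¹ ^ (p - 1) / 4 * Real.log n ^ 2) :
    (8 / resolution p n) ^ p *
        Real.exp (⌈c₀ * 2⁻¹ ^ (p - 1) / 4 * (resolution p n ^ 2)⁻¹⌉₊ -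
          n * (c₀ * (resolution p n / 2) ^ (p - 1)) / 2) ≤ 1 / n := by
  have hη := resolution_pos (p := p) hn
  have hn' : (0 : ℝ) < n := by exact_mod_cast hn
  have hnη := mul_resolution_pow_pred (p := p) (by omega) hn
  set η := resolution p n
  set ℓ := Real.log n with hℓd
  have hexp : Real.exp ℓ = n := Real.exp_log hn'
  have hpre : (8 / η) ^ p ≤ Real.exp (3 * p) * n :=
    (div_resolution_pow_le hn (by norm_num)).trans (by gcongr; exact eight_pow_le p)
  set Q := c₀ * (2⁻¹ : ℝ) ^ (p - 1) / 4 with hQ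
  have hQ0 : 0 < Q := by positivity
  have hN : (⌈Q * (η ^ 2)⁻¹⌉₊ : ℝ) ≤ Q * (η ^ 2)⁻¹ + 1 := (Nat.ceil_lt_add_one (by positivity)).le
  have hsq : ℓ ^ 2 ≤ (η ^ 2)⁻¹ := by
    rw [← inv_pow]
    exact pow_le_pow_left₀ hℓ ((le_inv_mul_iff₀ hη).2 (by linarith) |>.trans_eq (mul_one _)) 2
  have hmain : (n : ℝ) * (c₀ * (η / 2) ^ (p - 1)) / 2 = 2 * (Q * (η ^ 2)⁻¹) := by
    rw [← hnη, hQ, div_eq_mul_inv η 2, mul_pow]; ring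
  have hQℓ := mul_le_mul_of_nonneg_left hsq hQ0.le
  have hexpo : (⌈Q * (η ^ 2)⁻¹⌉₊ : ℝ) - n * (c₀ * (η / 2) ^ (p - 1)) / 2 ≤ 1 - Q * ℓ ^ 2 := by
    linarith
  calc _ ≤ (Real.exp (3 * p) * n) * Real.exp (1 - Q * ℓ ^ 2) := by gcongr
    _ = Real.exp (3 * p + ℓ + (1 - Q * ℓ ^ 2)) := by
        rw [← hexp, ← Real.exp_add, ← Real.exp_add]
    _ ≤ Real.exp (-ℓ) := by rw [Real.exp_le_exp]; linarith
    _ = 1 / n := by rw [Real.exp_neg, hexp, one_div]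

/-- The Hoeffding exponent `N * (ε * t) ^ 2 / L ^ 2` is of order `log² n`. -/
lemma average_term_le (hn : 1 ≤ n) {Q t : ℝ} (ht : 0 < t) (hQ : 0 < Q) (hℓ : 0 < Real.log n)
    (hlarge : 1 + 2 * Real.log n ≤ Q / 4608 * Real.log n ^ 2) :
    numDirections p n * (2 * Real.exp (-(2 * ⌈Q * (resolution p n ^ 2)⁻¹⌉₊ *
        (Real.log n ^ 2 * resolution p n * (t / 8)) ^ 2 / (12 * t * Real.log n) ^ 2))) ≤ 1 / n := by
  have hη := resolution_pos (p := p) hn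
  have hn' : (0 : ℝ) < n := by exact_mod_cast hn
  have hM : (numDirections p n : ℝ) ≤ n := by exact_mod_cast numDirections_le (p := p) hn
  set η := resolution p n
  set ℓ := Real.log n with hℓd
  have hexp : Real.exp ℓ = n := Real.exp_log hn'
  have hN : Q * (η ^ 2)⁻¹ ≤ (⌈Q * (η ^ 2)⁻¹⌉₊ : ℝ) := Nat.le_ceil _
  have hexpo : Q / 4608 * ℓ ^ 2 ≤ 2 * ⌈Q * (η ^ 2)⁻¹⌉₊ * (ℓ ^ 2 * η * (t / 8)) ^ 2 /
      (12 * t * ℓ) ^ 2 := by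
    calc Q / 4608 * ℓ ^ 2 = 2 * (Q * (η ^ 2)⁻¹) * (ℓ ^ 2 * η * (t / 8)) ^ 2 /
          (12 * t * ℓ) ^ 2 := by field_simp; norm_num
      _ ≤ _ := by gcongr
  have h2 : (2 : ℝ) ≤ Real.exp 1 := by linarith [Real.add_one_le_exp (1 : ℝ)]
  calc _ ≤ n * (Real.exp 1 * Real.exp (-(Q / 4608 * ℓ ^ 2))) := by gcongr
    _ = Real.exp (ℓ + (1 + -(Q / 4608 * ℓ ^ 2))) := by rw [Real.exp_add, Real.exp_add, hexp]
    _ ≤ Real.exp (-ℓ) := by rw [Real.exp_le_exp]; linarith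
    _ = 1 / n := by rw [Real.exp_neg, hexp, one_div]

lemma tail_term_le (hn : 1 ≤ n) {A t : ℝ} (ht : 0 < t) (hA : 0 ≤ A) :
    n * (A * Real.exp (-(12 * t * Real.log n / (4 * t)))) ≤ A / n := by
  have hn' : (0 : ℝ) < n := by exact_mod_cast hn
  have hn1 : (1 : ℝ) ≤ n := by exact_mod_cast hn
  have : Real.exp (-(12 * t * Real.log n / (4 * t))) = 1 / (n : ℝ) ^ 3 := by
    rw [show 12 * t * Real.log n / (4 * t) = (3 : ℕ) * Real.log n by push_cast; field_simp; ring,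
      Real.exp_neg, Real.exp_nat_mul, Real.exp_log hn', one_div]
  rw [this]
  calc (n : ℝ) * (A * (1 / n ^ 3)) = A / n * (1 / n) := by field_simp
    _ ≤ A / n := mul_le_of_le_one_right (by positivity) (by rwa [div_le_one hn'])

lemma tailConst_nonneg (p : ℕ) {r₀ : ℝ} (hr₀ : 0 ≤ r₀) : 0 ≤ tailConst p r₀ := by
  have : 0 ≤ ∫ x : EuclideanSpace ℝ (Fin p), Real.exp (-‖x‖) :=
    integral_nonneg fun x => (Real.exp_pos _).le
  rw [tailConst]
  positivity

/-- For large `n` the error bound holds up to probability of order `1 / n`. The parameters of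
`one_le_prob_add_of_isPolarLaw` are `η = resolution p n`, `δ = ε = log² n * η`, `N` of order `η⁻²`,
and `L = 12 * t * log n`, for which the tail bound of the gauge is of order `n⁻³`. -/
lemma one_le_prob_add_div (hp : 2 ≤ p) (hn : 1 ≤ n) {K : Set (EuclideanSpace ℝ (Fin p))}
    (hK : IsBodyAroundZero K) {μ : Measure (EuclideanSpace ℝ (Fin p))} {A t : ℝ} (hc₀ : 0 < c₀)
    (hC : 0 ≤ C) (hA : 0 ≤ A) (hμ : IsPolarLaw K μ c₀ C A t) {r₁ r₂ : ℝ} (h₁ : 0 < r₁)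
    (h₂ : r₁ ≤ r₂) (hb₁ : Metric.closedBall 0 r₁ ⊆ K) (hb₂ : K ⊆ Metric.closedBall 0 r₂)
    (hrate : scaleRate p n (r₂ / r₁) ≤ 1 / 64) (hℓ2 : 2 ≤ Real.log n)
    (hlarge : 3 * p + 1 + 3 * Real.log n ≤
      c₀ * 2⁻¹ ^ (p - 1) / 4 / 4608 * Real.log n ^ 2)
    {Ω : Type*} [MeasurableSpace Ω] {P : Measure Ω} [IsProbabilityMeasure P]
    {X : Fin (n + numDirections p n) → Ω → EuclideanSpace ℝ (Fin p)}
    (hX : ∀ i, Measurable (X i)) (hind : iIndepFun X P) (hlaw : ∀ i, P.map (X i) = μ) :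
    1 ≤ P.real {ω | (⨅ (α : ℝ) (_ : 0 < α), dScale (α • estimateK (fun i => X i ω)) K) ≤
          ENNReal.ofReal (10 * scaleRate p n (r₂ / r₁))} +
        (A + 2 ^ p * Real.exp (2 * C * 4 ^ (p - 1) * Real.exp 3 + 3) + 3) * (1 / n) := by
  obtain ⟨Q, hQd⟩ : ∃ Q, Q = c₀ * (2⁻¹ : ℝ) ^ (p - 1) / 4 := ⟨_, rfl⟩
  have hQ : 0 < Q := by rw [hQd]; positivity
  have hQc : Q ≤ c₀ / 4 := by
    have h : (2⁻¹ : ℝ) ^ (p - 1) ≤ 1 := pow_le_one₀ (by norm_num) (by norm_num)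
    rw [hQd]
    linarith only [mul_le_of_le_one_right hc₀.le h]
  have hr₀ : 1 ≤ r₂ / r₁ := by rwa [one_le_div h₁]
  have hη := resolution_pos (p := p) hn
  have hη1 := resolution_le_one (p := p) hn
  have ht := hμ.scale_pos
  have hℓη : Real.log n * resolution p n ≤ Real.log n ^ 2 * resolution p n := by
    gcongr; nlinarith only [hℓ2]
  have hη4 : 4 * resolution p n ≤ Real.log n ^ 2 * resolution p n := by
    gcongr; nlinarith only [hℓ2]
  have hrδ : r₂ / r₁ * (Real.log n ^ 2 * resolution p n) ≤ scaleRate p n (r₂ / r₁) := by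
    rw [scaleRate_eq hn]
    have h3 : Real.log n ^ 2 ≤ (1 + Real.log n) ^ 3 :=
      (pow_le_pow_left₀ (by linarith only [hℓ2]) (by linarith only) 2).trans
        (pow_le_pow_right₀ (by linarith only [hℓ2]) (by norm_num))
    have h4 : r₂ / r₁ ≤ (r₂ / r₁) ^ 2 := le_self_pow₀ hr₀ two_ne_zero
    calc r₂ / r₁ * (Real.log n ^ 2 * resolution p n)
        ≤ (r₂ / r₁) ^ 2 * ((1 + Real.log n) ^ 3 * resolution p n) := by gcongr
      _ = _ := by ring
  have hδpos : 0 < Real.log n ^ 2 * resolution p n := by positivity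
  have hδr := le_mul_of_one_le_left hδpos.le hr₀
  have hℓη1 : Real.log n * resolution p n ≤ 1 := by linarith only [hℓη, hδr, hrδ, hrate]
  have hk : 1 ≤ ⌊Real.log n⌋₊ := (Nat.one_le_floor_iff _).2 (by linarith only [hℓ2])
  have hkM : ⌊Real.log n⌋₊ ≤ numDirections p n := by
    have h3 : (⌊Real.log n⌋₊ : ℝ) ≤ Real.log n := Nat.floor_le (by linarith only [hℓ2])
    have h5 : resolution p n ^ (p - 1) ≤ resolution p n :=
      pow_le_of_le_one hη.le hη1 (by omega)
    have h6 : (1 : ℝ) ≤ numDirections p n * resolution p n :=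
      (one_le_numDirections_mul (p := p) (by omega) hn).trans (by gcongr)
    have h7 : Real.log n * resolution p n ≤ numDirections p n * resolution p n := hℓη1.trans h6
    exact_mod_cast h3.trans (le_of_mul_le_mul_right h7 hη)
  have hN : 1 ≤ ⌈Q * (resolution p n ^ 2)⁻¹⌉₊ := Nat.one_le_ceil_iff.2 (by positivity)
  have hmain := one_le_prob_add_of_isPolarLaw hK hμ hX hind hlaw h₁ h₂ hb₁ hb₂ rfl hk hkM hN
    (δ := Real.log n ^ 2 * resolution p n) (η := resolution p n)
    (ε := Real.log n ^ 2 * resolution p n) (L := 12 * t * Real.log n)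
    (E := 10 * scaleRate p n (r₂ / r₁)) (l := 3) hδpos (by linarith only [hδr, hrδ, hrate])
    (by linarith only [hrδ, hrate]) hη (by linarith only [hη4, hδr, hrδ, hrate])
    hδpos.le (by linarith only [hδr, hrδ, hrate]) (by nlinarith only [ht, hℓ2])
    (by linarith only [hδr, hrδ]) (by linarith only [hδpos, hδr, hrδ]) (by norm_num)
  have hlarge' : 3 * p + 1 + 3 * Real.log n ≤ Q * Real.log n ^ 2 := by
    rw [← hQd] at hlarge
    exact hlarge.trans (mul_le_mul_of_nonneg_right (by linarith only [hQ]) (sq_nonneg _))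
  have f1 := tail_term_le hn ht hA
  have f2 := few_directions_term_le hp hn hc₀ hℓ2
    (hlarge'.trans (mul_le_mul_of_nonneg_right hQc (sq_nonneg _)))
  have f3 := many_directions_term_le hp hn hC
  have f4 := few_observations_term_le hp hn hc₀ hℓη1 (by linarith only [hℓ2])
    (by rwa [← hQd])
  have f5 := average_term_le (p := p) hn ht hQ (by linarith only [hℓ2])
    (by
      rw [← hQd] at hlarge
      have hp0 : (0 : ℝ) ≤ p := Nat.cast_nonneg p
      linarith only [hlarge, hp0, hℓ2])
  rw [← hQd] at f4
  calc (1 : ℝ) ≤ _ := hmain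
    _ ≤ P.real {ω | (⨅ (α : ℝ) (_ : 0 < α), dScale (α • estimateK (fun i => X i ω)) K) ≤
          ENNReal.ofReal (10 * scaleRate p n (r₂ / r₁))} + A / n + 1 / n +
        2 ^ p * Real.exp (2 * C * 4 ^ (p - 1) * Real.exp 3 + 3) / n + 1 / n + 1 / n := by
        gcongr
    _ = _ := by ring

end Rates

theorem proposition10 :
    ∃ C : ℝ, 0 < C ∧
      ∀ p : ℕ, 2 ≤ p → ∀ r₀ : ℝ, ∃ C' : ℝ, 0 < C' ∧
        ∀ n : ℕ, 1 ≤ n →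
        ∀ K : Set (EuclideanSpace ℝ (Fin p)), IsBodyAroundZero K →
        ∀ r₁ r₂ : ℝ, 0 < r₁ → r₁ ≤ r₂ → r₀ = r₂ / r₁ →
        Metric.closedBall 0 r₁ ⊆ K → K ⊆ Metric.closedBall 0 r₂ →
        scaleRate p n r₀ ≤ 1 / 64 →
        ∀ f₀ : EuclideanSpace ℝ (Fin p) → ℝ≥0∞, IsHomotheticLogConcaveDensity K f₀ →
        ∀ (Ω : Type*) [MeasurableSpace Ω] (P : Measure Ω) [IsProbabilityMeasure P]
          (X : Fin (n + numDirections p n) → Ω → EuclideanSpace ℝ (Fin p)),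
        (∀ i, Measurable (X i)) → iIndepFun X P →
        (∀ i, P.map (X i) = volume.withDensity f₀) →
        1 - C' * (n : ℝ) ^ (-((p : ℝ) / ((p : ℝ) + 1))) ≤
          P.real {ω | (⨅ (α : ℝ) (_ : 0 < α), dScale (α • estimateK (fun i => X i ω)) K) ≤
            ENNReal.ofReal (C * scaleRate p n r₀)} := by
  refine ⟨10, by norm_num, fun p hp r₀ => ?_⟩
  rcases lt_or_ge r₀ 1 with hr₀ | hr₀
  · -- there is no body with `r₂ / r₁ < 1`
    refine ⟨1, one_pos, fun n hn K hK r₁ r₂ h₁ h₂ hr => absurd hr₀ (not_lt.2 ?_)⟩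
    rwa [hr, one_le_div h₁]
  have hc₀ : 0 < (8 * r₀)⁻¹ ^ p := by positivity
  have hC : 0 ≤ 3 * (3 * r₀) ^ p := by positivity
  have hA : 0 ≤ tailConst p r₀ := tailConst_nonneg p (by linarith)
  have hQ : 0 < (8 * r₀)⁻¹ ^ p * 2⁻¹ ^ (p - 1) / 4 / 4608 := by positivity
  obtain ⟨B, hB⟩ : ∃ B, B = tailConst p r₀ +
    2 ^ p * Real.exp (2 * (3 * (3 * r₀) ^ p) * 4 ^ (p - 1) * Real.exp 3 + 3) + 3 := ⟨_, rfl⟩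
  have hB0 : 0 ≤ B := by rw [hB]; positivity
  -- beyond this value of `log n` the quadratic exponents beat all linear terms
  obtain ⟨ℓ₀, hℓ₀⟩ : ∃ ℓ₀, ℓ₀ = (3 * (p : ℝ) + 4) /
    ((8 * r₀)⁻¹ ^ p * 2⁻¹ ^ (p - 1) / 4 / 4608) + 2 := ⟨_, rfl⟩
  refine ⟨Real.exp ℓ₀ + B, by positivity,
    fun n hn K hK r₁ r₂ h₁ h₂ hr hb₁ hb₂ hrate f₀ hf₀ Ω _ P _ X hX hind hlaw => ?_⟩
  have hn1 : (1 : ℝ) ≤ n := by exact_mod_cast hn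
  have hn' : (0 : ℝ) < n := by linarith
  have hpow : 1 / (n : ℝ) ≤ (n : ℝ) ^ (-((p : ℝ) / ((p : ℝ) + 1))) := by
    rw [one_div, ← Real.rpow_neg_one]
    refine Real.rpow_le_rpow_of_exponent_le hn1 ?_
    rw [neg_le_neg_iff, div_le_one (by positivity)]
    linarith
  have hpow' := mul_le_mul_of_nonneg_left hpow (by positivity : 0 ≤ Real.exp ℓ₀ + B)
  rcases lt_or_ge (Real.log n) ℓ₀ with hsmall | hℓ
  · -- for small `n` the claimed probability is nonpositive
    refine le_trans ?_ measureReal_nonneg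
    have h3 : (n : ℝ) ≤ Real.exp ℓ₀ := by
      rw [← Real.exp_log hn']
      exact Real.exp_le_exp.2 hsmall.le
    have h4 : 1 ≤ (Real.exp ℓ₀ + B) * (1 / n) := by
      rw [mul_one_div, one_le_div hn']; linarith
    linarith
  have hdiv : 0 ≤ (3 * (p : ℝ) + 4) / ((8 * r₀)⁻¹ ^ p * 2⁻¹ ^ (p - 1) / 4 / 4608) := by
    positivity
  have hℓ2 : 2 ≤ Real.log n := by linarith
  have hlarge : 3 * p + 1 + 3 * Real.log n ≤
      (8 * r₀)⁻¹ ^ p * 2⁻¹ ^ (p - 1) / 4 / 4608 * Real.log n ^ 2 := by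
    have h3 : (3 * (p : ℝ) + 4) / ((8 * r₀)⁻¹ ^ p * 2⁻¹ ^ (p - 1) / 4 / 4608) ≤ Real.log n := by
      linarith
    rw [div_le_iff₀ hQ] at h3
    have h4 := mul_le_mul_of_nonneg_right h3 (by linarith : 0 ≤ Real.log n)
    have h5 : (3 * (p : ℝ) + 1) * 1 ≤ (3 * p + 1) * Real.log n := by gcongr; linarith
    linarith
  obtain ⟨t, hμ⟩ := hf₀.exists_isPolarLaw hp hK h₁ h₂ hb₁ hb₂
  rw [hr] at hc₀ hC hA hlarge hrate
  have hmain := one_le_prob_add_div hp hn hK hc₀ hC hA hμ h₁ h₂ hb₁ hb₂ hrate hℓ2 hlarge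
    hX hind hlaw
  rw [← hr, ← hB] at hmain
  have : 0 ≤ Real.exp ℓ₀ * (1 / n) := by positivity
  linarith
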